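/- All graphs are finite and simple. A graph is \emph{planar} if it can be drawn in the plane with its vertices as distinct points and each edge as a polygonal curve joining its two ends, such that no edge passes through a vertex other than its ends and any two distinct edges meet only in common ends. A \emph{total-$k$-coloring} of a graph assigns to each vertex and each edge a color from a fixed set of $k$ colors such that adjacent vertices receive distinct colors, distinct edges sharing an end receive distinct colors, and no edge receives the color of one of its ends. If $H$ is a (not necessarily induced or spanning) subgraph of $G$, a total-$k$-coloring $\varphi$ of $H$ is a \emph{total-$k$-coloring of $H$ in $G$} if, in addition, any two vertices of $H$ that are adjacent in $G$ receive distinct colors under $\varphi$. Theorem. Let $G$ be a planar graph with maximum degree $\Delta$, and let $H$ be a subgraph of $G$ with maximum degree $d$ (where a graph without vertices has maximum degree $0$). Then every total-$(\Delta+d+6)$-coloring $\varphi$ of $H$ in $G$ extends to $G$; that is, there is a total-$(\Delta+d+6)$-coloring of $G$ that agrees with $\varphi$ on all vertices and edges of $H$. -/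

import Mathlib

/-- The Euclidean plane. -/
abbrev Plane : Type := EuclideanSpace ℝ (Fin 2)

/-- `S` is a polygonal curve from `a` to `b`: the union of finitely many consecutive line
segments `[p 0, p 1], [p 1, p 2], …, [p (n - 1), p n]` with `p 0 = a` and `p n = b`. -/
def IsPolygonalCurve (a b : Plane) (S : Set Plane) : Prop :=
  ∃ (n : ℕ) (p : ℕ → Plane), p 0 = a ∧ p n = b ∧
    S = ⋃ i ∈ Set.Iio n, segment ℝ (p i) (p (i + 1))

/-- A drawing of `G` in the plane without crossings: the vertices are drawn as distinct points,
each edge as a polygonal curve joining its two ends and containing no other vertex, and two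
distinct edges meet only in common ends. -/
structure IsPlanarDrawing {V : Type*} (G : SimpleGraph V)
    (point : V → Plane) (curve : G.edgeSet → Set Plane) : Prop where
  point_injective : Function.Injective point
  isPolygonalCurve : ∀ (u v : V) (h : G.Adj u v),
    IsPolygonalCurve (point u) (point v) (curve ⟨s(u, v), h⟩)
  mem_of_point_mem : ∀ (e : G.edgeSet) (w : V), point w ∈ curve e → w ∈ (e : Sym2 V)
  no_crossing : ∀ e f : G.edgeSet, e ≠ f → ∀ x ∈ curve e ∩ curve f,
    ∃ w : V, w ∈ (e : Sym2 V) ∧ w ∈ (f : Sym2 V) ∧ x = point w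

/-- A graph is planar if it has a drawing in the plane without crossings. -/
def SimpleGraph.IsPlanar {V : Type*} (G : SimpleGraph V) : Prop :=
  ∃ (point : V → Plane) (curve : G.edgeSet → Set Plane), IsPlanarDrawing G point curve

/-- A total-`k`-coloring of `G`: a proper coloring of the vertices together with a proper coloring
of the edges, both with colors from `Fin k`, in which no edge has the color of one of its ends. -/
structure TotalColoring {V : Type*} (G : SimpleGraph V) (k : ℕ) where
  vert : G.Coloring (Fin k)
  edge : G.lineGraph.Coloring (Fin k)
  edge_ne_vert : ∀ (e : G.edgeSet) (v : V), v ∈ (e : Sym2 V) → edge e ≠ vert v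

/-- A total coloring of the subgraph `H` is a total coloring of `H` in `G` if vertices of `H` that
are adjacent in `G` (and possibly not in `H`) receive distinct colors. -/
def TotalColoring.IsColoringIn {V : Type*} {G : SimpleGraph V} {H : G.Subgraph} {k : ℕ}
    (φ : TotalColoring H.coe k) : Prop :=
  ∀ u v : H.verts, G.Adj u v → φ.vert u ≠ φ.vert v

/-- The total coloring `ψ` of `G` agrees with `φ` on all vertices and edges of the subgraph `H`. -/
def TotalColoring.Extends {V : Type*} {G : SimpleGraph V} {H : G.Subgraph} {k : ℕ}
    (ψ : TotalColoring G k) (φ : TotalColoring H.coe k) : Prop :=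
  (∀ v : H.verts, ψ.vert v = φ.vert v) ∧
    ∀ e : H.coe.edgeSet, ψ.edge (H.hom.mapEdgeSet e) = φ.edge e

/-! The coloring is greedy. More than `Δ` colors suffice to extend the vertex coloring. The edges
still to be colored form a planar graph `F`, which has an edge `vw` with `v` of degree at most five
in `F`. Color all edges but `vw` by induction. Then `vw` must avoid at most `d + 4` colors of edges
at `v`, `Δ - 1` colors of edges at `w` and the two colors of its ends, so at most `Δ + d + 5` in
all.

The degree bound needs `|E| < 3|V|` for a drawing in which each end of an edge lies on another edge.
This comes from homology, without the Jordan curve theorem, Euler's formula or connectedness. The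
space of edge weightings with zero boundary has dimension at least `|E| - |V| + 1`. The winding
number of such a weighting is constant on each face and jumps by `2πi` times the weight across an
edge (`IsFace.winding_eq`, `IsSegmentFamily.eq_zero_of_winding_eq_zero`), so the space embeds into
the functions on the faces. Hence `|E| + 1 ≤ f + |V|`, where `f` counts the faces touching an edge.
Such a face touches at least three edges, and an edge is touched by at most two faces, so `3f ≤
2|E|`. -/

/-! ### Faces of a finite union of segments -/

/-- A family of nondegenerate segments, any two of which meet only in common ends. -/
structure IsSegmentFamily {K : Type*} (a b : K → ℂ) : Prop where
  ne : ∀ k, a k ≠ b k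
  eq_end : ∀ k l, k ≠ l → ∀ x ∈ segment ℝ (a k) (b k), x ∈ segment ℝ (a l) (b l) →
    x = a k ∨ x = b k

/-- The union of a family of segments. -/
def segmentUnion {K : Type*} (a b : K → ℂ) : Set ℂ := ⋃ k, segment ℝ (a k) (b k)

/-- The faces of a set `S` are the connected components of its complement. -/
structure IsFace (S U : Set ℂ) : Prop where
  nonempty : U.Nonempty
  isOpen : IsOpen U
  isPreconnected : IsPreconnected U
  subset_compl : U ⊆ Sᶜ
  subset_of_inter : ∀ T : Set ℂ, IsPreconnected T → T ⊆ Sᶜ → (T ∩ U).Nonempty → T ⊆ U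

/-- A face touches a segment if some interior point of the segment lies in its closure. -/
def Touches (U : Set ℂ) (a b : ℂ) : Prop := (closure U ∩ openSegment ℝ a b).Nonempty

theorem isClosed_segment_complex (a b : ℂ) : IsClosed (segment ℝ a b) := by
  rw [← closure_openSegment]
  exact isClosed_closure

theorem isClosed_segmentUnion {K : Type*} [Finite K] (a b : K → ℂ) :
    IsClosed (segmentUnion a b) :=
  isClosed_iUnion_of_finite fun _ => isClosed_segment_complex _ _

theorem isFace_connectedComponentIn {S : Set ℂ} (hS : IsClosed S) {x : ℂ} (hx : x ∉ S) :
    IsFace S (connectedComponentIn Sᶜ x) where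
  nonempty := ⟨x, mem_connectedComponentIn hx⟩
  isOpen := hS.isOpen_compl.connectedComponentIn
  isPreconnected := isPreconnected_connectedComponentIn
  subset_compl := connectedComponentIn_subset _ _
  subset_of_inter := by
    rintro T hT hTS ⟨y, hyT, hyU⟩
    rw [connectedComponentIn_eq hyU]
    exact hT.subset_connectedComponentIn hyT hTS

theorem exists_isFace_superset {S : Set ℂ} (hS : IsClosed S) {T : Set ℂ} (hT : IsPreconnected T)
    (hne : T.Nonempty) (hTS : T ⊆ Sᶜ) : ∃ U, IsFace S U ∧ T ⊆ U := by
  obtain ⟨x, hx⟩ := hne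
  exact ⟨_, isFace_connectedComponentIn hS (hTS hx), hT.subset_connectedComponentIn hx hTS⟩

theorem IsFace.eq_of_inter {S U W : Set ℂ} (hU : IsFace S U) (hW : IsFace S W)
    (h : (U ∩ W).Nonempty) : U = W :=
  (hW.subset_of_inter U hU.isPreconnected hU.subset_compl h).antisymm
    (hU.subset_of_inter W hW.isPreconnected hW.subset_compl (by rwa [Set.inter_comm]))

theorem IsFace.closure_subset {S U : Set ℂ} (hS : IsClosed S) (hU : IsFace S U) :
    closure U ⊆ U ∪ S := by
  intro x hx
  by_contra hn
  rw [Set.mem_union, not_or] at hn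
  obtain ⟨r, hr, hb⟩ := Metric.isOpen_iff.1 hS.isOpen_compl x hn.2
  obtain ⟨y, hyU, hy⟩ := Metric.mem_closure_iff.1 hx r hr
  refine hn.1 (hU.subset_of_inter _ (convex_ball x r).isPreconnected hb
    ⟨y, ?_, hyU⟩ (Metric.mem_ball_self hr))
  rwa [Metric.mem_ball, dist_comm]

/-- The signed distance, up to scaling, of `y` from the line through `a` and `b`. -/
noncomputable def sideOf (a b y : ℂ) : ℝ := ((y - a) / (b - a)).im

theorem sideOf_eq_zero {a b y : ℂ} (hab : a ≠ b) (h : y ∈ segment ℝ a b) : sideOf a b y = 0 := by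
  obtain ⟨s, t, -, -, hst, rfl⟩ := h
  have h1 : b - a ≠ 0 := sub_ne_zero.2 hab.symm
  have : (s • a + t • b - a) / (b - a) = (t : ℂ) := by
    rw [div_eq_iff h1]
    have : (s : ℂ) = 1 - t := by rw [eq_sub_iff_add_eq]; exact_mod_cast hst
    simp only [Complex.real_smul, this]; ring
  rw [sideOf, this, Complex.ofReal_im]

theorem sideOf_add {a b : ℂ} (hab : a ≠ b) (y : ℂ) (t : ℝ) :
    sideOf a b (y + t * (Complex.I * (b - a))) = sideOf a b y + t := by
  have h1 : b - a ≠ 0 := sub_ne_zero.2 hab.symm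
  have : (y + t * (Complex.I * (b - a)) - a) / (b - a) = (y - a) / (b - a) + t * Complex.I := by
    field_simp; ring
  simp [sideOf, this]

theorem convex_sideOf_pos (a b : ℂ) : Convex ℝ {y | 0 < sideOf a b y} := by
  intro x hx y hy s t hs ht hst
  have : sideOf a b (s • x + t • y) = s * sideOf a b x + t * sideOf a b y := by
    have h2 : (s • x + t • y - a) / (b - a) =
        s * ((x - a) / (b - a)) + t * ((y - a) / (b - a)) := by
      have : (s : ℂ) + t = 1 := by exact_mod_cast hst
      simp only [Complex.real_smul]
      linear_combination (a / (b - a)) * this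
    rw [sideOf, h2]; simp [sideOf]
  simp only [Set.mem_ofPred_eq] at *
  rw [this]
  rcases hs.eq_or_lt with rfl | hs
  · have : t = 1 := by linarith
    subst this; simpa using hy
  · have := mul_pos hs hx
    have := mul_nonneg ht hy.le
    linarith

theorem sideOf_swap {a b : ℂ} (hab : a ≠ b) (y : ℂ) : sideOf b a y = - sideOf a b y := by
  have h1 : b - a ≠ 0 := sub_ne_zero.2 hab.symm
  have h2 : a - b ≠ 0 := sub_ne_zero.2 hab
  have : (y - b) / (a - b) = 1 - (y - a) / (b - a) := by
    rw [div_eq_iff h2]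
    have : (y - a) / (b - a) * (a - b) = -(y - a) := by field_simp; ring
    linear_combination this
  simp [sideOf, this]

/-- The part of a ball on the left of the line from `a` to `b`. -/
def halfBall (a b x : ℂ) (r : ℝ) : Set ℂ := Metric.ball x r ∩ {y | 0 < sideOf a b y}

theorem isPreconnected_halfBall (a b x : ℂ) (r : ℝ) : IsPreconnected (halfBall a b x r) :=
  ((convex_ball x r).inter (convex_sideOf_pos a b)).isPreconnected

theorem mem_closure_halfBall {a b x y : ℂ} {r : ℝ} (hab : a ≠ b) (hy : y ∈ Metric.ball x r)
    (h0 : sideOf a b y = 0) : y ∈ closure (halfBall a b x r) := by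
  have hc : Continuous fun t : ℝ => y + t * (Complex.I * (b - a)) := by fun_prop
  have ht : Filter.Tendsto (fun t : ℝ => y + t * (Complex.I * (b - a)))
      (nhdsWithin 0 (Set.Ioi 0)) (nhds y) := by
    have := (hc.tendsto 0).mono_left (nhdsWithin_le_nhds (s := Set.Ioi 0))
    simpa using this
  refine mem_closure_of_tendsto ht ?_
  filter_upwards [ht (Metric.isOpen_ball.mem_nhds hy), self_mem_nhdsWithin] with t h1 h2
  refine ⟨h1, ?_⟩
  simpa [sideOf_add hab, h0] using h2

namespace IsSegmentFamily

variable {K : Type*} [Finite K] {a b : K → ℂ}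

theorem exists_ball (h : IsSegmentFamily a b) {k : K} {x : ℂ}
    (hx : x ∈ openSegment ℝ (a k) (b k)) :
    ∃ r > 0, ∀ y ∈ Metric.ball x r, y ∈ segmentUnion a b → y ∈ segment ℝ (a k) (b k) := by
  have hT : IsClosed (⋃ l : {l // l ≠ k}, segment ℝ (a l) (b l)) :=
    isClosed_iUnion_of_finite fun _ => isClosed_segment_complex _ _
  have hxT : x ∉ ⋃ l : {l // l ≠ k}, segment ℝ (a l) (b l) := by
    simp only [Set.mem_iUnion, not_exists]
    rintro ⟨l, hl⟩ hxl
    rcases h.eq_end k l hl.symm x (openSegment_subset_segment ℝ _ _ hx) hxl with rfl | rfl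
    · exact h.ne k (left_mem_openSegment_iff.1 hx)
    · exact h.ne k (right_mem_openSegment_iff.1 hx)
  obtain ⟨r, hr, hb⟩ := Metric.isOpen_iff.1 hT.isOpen_compl x hxT
  refine ⟨r, hr, fun y hy hyS => ?_⟩
  obtain ⟨l, hl⟩ := Set.mem_iUnion.1 hyS
  by_cases hlk : l = k
  · exact hlk ▸ hl
  · exact absurd (Set.mem_iUnion.2 ⟨⟨l, hlk⟩, hl⟩) (hb hy)

/-- Near an interior point of a segment there are only two sides. -/
theorem exists_halfBall (h : IsSegmentFamily a b) {k : K} {x : ℂ}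
    (hx : x ∈ openSegment ℝ (a k) (b k)) :
    ∃ r > 0, halfBall (a k) (b k) x r ⊆ (segmentUnion a b)ᶜ ∧
      halfBall (b k) (a k) x r ⊆ (segmentUnion a b)ᶜ ∧
      ∀ U, IsFace (segmentUnion a b) U → x ∈ closure U →
        halfBall (a k) (b k) x r ⊆ U ∨ halfBall (b k) (a k) x r ⊆ U := by
  obtain ⟨r, hr, hb⟩ := h.exists_ball hx
  have hL : halfBall (a k) (b k) x r ⊆ (segmentUnion a b)ᶜ := fun y hy hyS =>
    hy.2.ne' (sideOf_eq_zero (h.ne k) (hb y hy.1 hyS))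
  have hR : halfBall (b k) (a k) x r ⊆ (segmentUnion a b)ᶜ := fun y hy hyS =>
    hy.2.ne' (sideOf_eq_zero (h.ne k).symm (segment_symm ℝ (a k) (b k) ▸ hb y hy.1 hyS))
  refine ⟨r, hr, hL, hR, fun U hU hxU => ?_⟩
  obtain ⟨y₀, hy₀U, hy₀⟩ := Metric.mem_closure_iff.1 hxU r hr
  have hop : IsOpen (U ∩ Metric.ball x r) := hU.isOpen.inter Metric.isOpen_ball
  have hy₀' : y₀ ∈ U ∩ Metric.ball x r := ⟨hy₀U, by rwa [Metric.mem_ball, dist_comm]⟩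
  -- A point of `U` on the line itself can be moved off it, since `U` is open.
  obtain ⟨y, hy, hne⟩ : ∃ y ∈ U ∩ Metric.ball x r, sideOf (a k) (b k) y ≠ 0 := by
    by_cases h0 : sideOf (a k) (b k) y₀ = 0
    · obtain ⟨y, hy, hy'⟩ := mem_closure_iff.1
        (mem_closure_halfBall (h.ne k) hy₀'.2 h0) _ hop hy₀'
      exact ⟨y, hy, hy'.2.ne'⟩
    · exact ⟨y₀, hy₀', h0⟩
  rcases hne.lt_or_gt with hlt | hgt
  · right
    exact hU.subset_of_inter _ (isPreconnected_halfBall _ _ _ _) hR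
      ⟨y, ⟨hy.2, by simpa [sideOf_swap (h.ne k)] using hlt⟩, hy.1⟩
  · left
    exact hU.subset_of_inter _ (isPreconnected_halfBall _ _ _ _) hL ⟨y, ⟨hy.2, hgt⟩, hy.1⟩

/-- The open segment is connected, and its part in `closure U` is relatively closed. It is also
relatively open: near such a point `U` contains a half ball, whose closure contains the nearby part
of the line. -/
theorem openSegment_subset_closure (h : IsSegmentFamily a b) {k : K} {U : Set ℂ}
    (hU : IsFace (segmentUnion a b) U) (ht : Touches U (a k) (b k)) :
    openSegment ℝ (a k) (b k) ⊆ closure U := by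
  intro y hy
  by_contra hyU
  -- An open subset of the plane that agrees with `closure U` on the open segment.
  let O : Set ℂ := {x | ∃ r > 0, ∀ y ∈ Metric.ball x r, sideOf (a k) (b k) y = 0 → y ∈ closure U}
  have hO : IsOpen O := by
    rw [Metric.isOpen_iff]
    rintro x ⟨r, hr, hx⟩
    refine ⟨r / 2, half_pos hr, fun z hz => ⟨r / 2, half_pos hr, fun w hw => hx w ?_⟩⟩
    rw [Metric.mem_ball] at *
    linarith [dist_triangle w z x]
  have hzero : ∀ x ∈ openSegment ℝ (a k) (b k), sideOf (a k) (b k) x = 0 := fun x hx =>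
    sideOf_eq_zero (h.ne k) (openSegment_subset_segment ℝ _ _ hx)
  have hmem : ∀ x ∈ openSegment ℝ (a k) (b k), x ∈ closure U → x ∈ O := by
    intro x hx hxU
    obtain ⟨r, hr, -, -, hh⟩ := h.exists_halfBall hx
    refine ⟨r, hr, fun z hz hz0 => ?_⟩
    rcases hh U hU hxU with h1 | h1
    · exact closure_mono h1 (mem_closure_halfBall (h.ne k) hz hz0)
    · exact closure_mono h1 (mem_closure_halfBall (h.ne k).symm hz (by
        rw [sideOf_swap (h.ne k), hz0, neg_zero]))
  obtain ⟨x, hxU, hx⟩ := ht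
  obtain ⟨z, hz, hzU, r, hr, hzO⟩ := (convex_openSegment (𝕜 := ℝ) (a k) (b k)).isPreconnected
    (closure U)ᶜ O isClosed_closure.isOpen_compl hO
    (fun z hz => by
      by_cases hzU : z ∈ closure U
      · exact Or.inr (hmem z hz hzU)
      · exact Or.inl hzU) ⟨y, hy, hyU⟩ ⟨x, hx, hmem x hx hxU⟩
  exact hzU (hzO z (Metric.mem_ball_self hr) (hzero z hz))

/-- The two faces, possibly equal, are those containing the half balls at the midpoint. -/
theorem exists_two_faces (h : IsSegmentFamily a b) (k : K) :
    ∃ U₁ U₂, ∀ U, IsFace (segmentUnion a b) U → Touches U (a k) (b k) → U = U₁ ∨ U = U₂ := by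
  have hx := midpoint_mem_openSegment (𝕜 := ℝ) (a k) (b k)
  obtain ⟨r, hr, hL, hR, hh⟩ := h.exists_halfBall hx
  have hS := isClosed_segmentUnion a b
  have h0 := sideOf_eq_zero (h.ne k) (openSegment_subset_segment ℝ _ _ hx)
  have hLn : (halfBall (a k) (b k) (midpoint ℝ (a k) (b k)) r).Nonempty := closure_nonempty_iff.1
    ⟨_, mem_closure_halfBall (h.ne k) (Metric.mem_ball_self hr) h0⟩
  have hRn : (halfBall (b k) (a k) (midpoint ℝ (a k) (b k)) r).Nonempty := closure_nonempty_iff.1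
    ⟨_, mem_closure_halfBall (h.ne k).symm (Metric.mem_ball_self hr)
      (by rw [sideOf_swap (h.ne k), h0, neg_zero])⟩
  obtain ⟨U₁, hU₁, h₁⟩ := exists_isFace_superset hS (isPreconnected_halfBall _ _ _ _) hLn hL
  obtain ⟨U₂, hU₂, h₂⟩ := exists_isFace_superset hS (isPreconnected_halfBall _ _ _ _) hRn hR
  refine ⟨U₁, U₂, fun U hU ht => ?_⟩
  rcases hh U hU (h.openSegment_subset_closure hU ht hx) with h3 | h3
  · exact Or.inl (hU.eq_of_inter hU₁ (hLn.mono (Set.subset_inter h3 h₁)))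
  · exact Or.inr (hU.eq_of_inter hU₂ (hRn.mono (Set.subset_inter h3 h₂)))

end IsSegmentFamily

/-! ### Local geometry at the end of a segment, and logarithms off a segment -/

/-- A ball without one of its radii is connected. -/
theorem isPreconnected_ball_diff_segment {q c : ℂ} {r : ℝ} (hqc : c ≠ q) (hrc : r ≤ dist c q) :
    IsPreconnected (Metric.ball q r \ segment ℝ q c) := by
  rcases le_or_gt r 0 with hr | hr
  · rw [Metric.ball_eq_empty.2 hr, Set.empty_sdiff]
    exact isPreconnected_empty
  have hd : 0 < dist c q := dist_pos.2 hqc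
  have hcq : c - q ≠ 0 := sub_ne_zero.2 hqc
  have hn : ‖c - q‖ = dist c q := (dist_eq_norm c q).symm
  -- on the ball, the points of the segment are the points of the ray
  have key : ∀ y ∈ Metric.ball q r, y ∈ segment ℝ q c ↔ ∃ t : ℝ, 0 ≤ t ∧ y = q + t * (c - q) := by
    intro y hy
    rw [segment_eq_image']
    constructor
    · rintro ⟨t, ht, rfl⟩
      exact ⟨t, ht.1, by simp⟩
    · rintro ⟨t, ht, rfl⟩
      refine ⟨t, ⟨ht, ?_⟩, by simp⟩
      rw [Metric.mem_ball, dist_eq_norm, add_sub_cancel_left, norm_mul, Complex.norm_real,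
        Real.norm_of_nonneg ht, hn] at hy
      by_contra hlt
      push Not at hlt
      nlinarith
  -- The slit ball is star-shaped about the point at distance `r / 2` from `q` opposite to `c`.
  set s : ℝ := r / (2 * dist c q) with hs
  have hs0 : 0 < s := by positivity
  have hsr : s * dist c q = r / 2 := by rw [hs]; field_simp
  have hcen : q - s * (c - q) ∈ Metric.ball q r \ segment ℝ q c := by
    have hb : q - s * (c - q) ∈ Metric.ball q r := by
      rw [Metric.mem_ball, dist_eq_norm, sub_sub_cancel_left, norm_neg, norm_mul, Complex.norm_real,
        Real.norm_of_nonneg hs0.le, hn, hsr]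
      linarith
    refine ⟨hb, fun hseg => ?_⟩
    obtain ⟨t, ht, e⟩ := (key _ hb).1 hseg
    have e' : ((t + s : ℝ) : ℂ) * (c - q) = 0 := by push_cast; linear_combination -e
    have : t + s = 0 := by exact_mod_cast (mul_eq_zero.1 e').resolve_right hcq
    linarith
  suffices hstar : StarConvex ℝ (q - s * (c - q)) (Metric.ball q r \ segment ℝ q c) from
    (hstar.isPathConnected hcen).isConnected.isPreconnected
  intro y hy α β hα hβ hαβ
  have hb := convex_ball q r hcen.1 hy.1 hα hβ hαβ
  refine ⟨hb, fun hseg => ?_⟩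
  rcases hβ.eq_or_lt with rfl | hβ
  · have : α = 1 := by linarith
    subst this
    simp only [one_smul, zero_smul, add_zero] at hseg
    exact hcen.2 hseg
  obtain ⟨t, ht, e⟩ := (key _ hb).1 hseg
  -- Solving `α (q - s (c - q)) + β y = q + t (c - q)` for `y` puts `y` on the ray too.
  refine hy.2 ((key y hy.1).2 ⟨(t + α * s) / β, by positivity, ?_⟩)
  have hβ' : (β : ℂ) ≠ 0 := by exact_mod_cast hβ.ne'
  have hα' : (α : ℂ) = 1 - β := by rw [eq_sub_iff_add_eq]; exact_mod_cast hαβ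
  simp only [Complex.real_smul] at e
  push_cast
  rw [hα'] at e ⊢
  field_simp
  linear_combination e

/-- If the ratio were a real number `-c ≤ 0`, then `p = (c a + b) / (1 + c)` would lie on the
segment. Thus the principal logarithm of the ratio is holomorphic off the segment. -/
theorem mem_slitPlane_of_notMem_segment {a b p : ℂ} (h : p ∉ segment ℝ a b) :
    (b - p) / (a - p) ∈ Complex.slitPlane := by
  have ha : a - p ≠ 0 := sub_ne_zero.2 fun e => h (e ▸ left_mem_segment ℝ a b)
  by_contra hn
  rw [Complex.mem_slitPlane_iff, not_or, not_lt, not_not] at hn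
  set c : ℝ := -((b - p) / (a - p)).re with hc
  have hc0 : 0 ≤ c := by linarith [hn.1]
  have h1 : (b - p) / (a - p) = -(c : ℂ) := by
    apply Complex.ext <;> simp [hc, hn.2]
  rw [div_eq_iff ha] at h1
  have hc1 : (1 + c : ℝ) ≠ 0 := by positivity
  have hc2 : (1 + c : ℂ) ≠ 0 := by exact_mod_cast hc1
  refine h ⟨c / (1 + c), 1 / (1 + c), by positivity, by positivity, by field_simp; ring, ?_⟩
  simp only [Complex.real_smul]
  push_cast
  field_simp
  linear_combination h1

theorem hasDerivAt_log_sub_div_sub {a b p : ℂ} (h : p ∉ segment ℝ a b) :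
    HasDerivAt (fun p => Complex.log ((b - p) / (a - p))) ((a - p)⁻¹ - (b - p)⁻¹) p := by
  have ha : a - p ≠ 0 := sub_ne_zero.2 fun e => h (e ▸ left_mem_segment ℝ a b)
  have hb : b - p ≠ 0 := sub_ne_zero.2 fun e => h (e ▸ right_mem_segment ℝ a b)
  have h1 := (((hasDerivAt_id p).const_sub b).div ((hasDerivAt_id p).const_sub a) ha).clog
    (mem_slitPlane_of_notMem_segment h)
  refine h1.congr_deriv ?_
  simp only [id, Pi.div_apply]
  field_simp
  ring

namespace IsSegmentFamily

variable {K : Type*} {a b : K → ℂ}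

/-- A face touching a segment also touches a further segment at each of its ends, if any. -/
theorem exists_touches_of_end [Finite K] (h : IsSegmentFamily a b) {k l₀ : K} {q c : ℂ} {U : Set ℂ}
    (hk : q = a k ∧ c = b k ∨ q = b k ∧ c = a k)
    (hU : IsFace (segmentUnion a b) U) (ht : Touches U (a k) (b k))
    (hl₀ : l₀ ≠ k) (hq : q ∈ segment ℝ (a l₀) (b l₀)) :
    ∃ l ≠ k, q ∈ segment ℝ (a l) (b l) ∧ Touches U (a l) (b l) := by
  have hS := isClosed_segmentUnion a b
  have hcq : c ≠ q := by
    rcases hk with ⟨rfl, rfl⟩ | ⟨rfl, rfl⟩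
    · exact (h.ne k).symm
    · exact h.ne k
  have hseg : segment ℝ (a k) (b k) = segment ℝ q c := by
    rcases hk with ⟨rfl, rfl⟩ | ⟨rfl, rfl⟩
    · rfl
    · exact segment_symm _ _ _
  have hoseg : openSegment ℝ (a k) (b k) = openSegment ℝ q c := by
    rcases hk with ⟨rfl, rfl⟩ | ⟨rfl, rfl⟩
    · rfl
    · exact openSegment_symm _ _ _
  have hqk : q ∈ segment ℝ (a k) (b k) := hseg ▸ left_mem_segment ℝ q c
  have hends : ∀ l, q ∈ segment ℝ (a l) (b l) → q = a l ∨ q = b l := by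
    intro l hl
    by_cases hlk : l = k
    · subst hlk
      exact hk.imp And.left And.left
    · exact h.eq_end l k hlk q hl hqk
  -- a radius so small that the ball reaches no segment and no end away from `q`
  have hfin : ∀ s : Set ℂ, IsClosed s → q ∉ s → ∀ᶠ r in nhdsWithin (0 : ℝ) (Set.Ioi 0),
      Disjoint (Metric.ball q r) s := by
    intro s hs hqs
    obtain ⟨r, hr, hb⟩ := Metric.isOpen_iff.1 hs.isOpen_compl q hqs
    filter_upwards [Ioo_mem_nhdsGT hr] with t ht
    exact Set.disjoint_left.2 fun y hy hys => hb (Metric.ball_subset_ball ht.2.le hy) hys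
  have hev : ∀ᶠ r in nhdsWithin (0 : ℝ) (Set.Ioi 0), 0 < r ∧ r ≤ dist c q ∧
      (∀ l, q ∉ segment ℝ (a l) (b l) → Disjoint (Metric.ball q r) (segment ℝ (a l) (b l))) ∧
      (∀ l, q ≠ a l → Disjoint (Metric.ball q r) {a l}) ∧
      (∀ l, q ≠ b l → Disjoint (Metric.ball q r) {b l}) := by
    refine (eventually_mem_nhdsWithin).and ?_
    refine Filter.Eventually.and ?_ (Filter.Eventually.and ?_ (Filter.Eventually.and ?_ ?_))
    · filter_upwards [Ioo_mem_nhdsGT (dist_pos.2 hcq)] with t ht using ht.2.le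
    · rw [Filter.eventually_all]
      intro l
      by_cases hl : q ∈ segment ℝ (a l) (b l)
      · exact Filter.Eventually.of_forall fun _ hn => absurd hl hn
      · filter_upwards [hfin _ (isClosed_segment_complex _ _) hl] with r hr _ using hr
    · rw [Filter.eventually_all]
      intro l
      by_cases hl : q = a l
      · exact Filter.Eventually.of_forall fun _ hn => absurd hl hn
      · filter_upwards [hfin _ isClosed_singleton (by simpa using hl)] with r hr _ using hr
    · rw [Filter.eventually_all]
      intro l
      by_cases hl : q = b l
      · exact Filter.Eventually.of_forall fun _ hn => absurd hl hn
      · filter_upwards [hfin _ isClosed_singleton (by simpa using hl)] with r hr _ using hr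
  obtain ⟨r, hr, hrc, hfar, hfa, hfb⟩ := hev.exists
  by_contra! hno
  have hqcl : q ∈ closure (openSegment ℝ q c) := by
    rw [closure_openSegment]
    exact left_mem_segment ℝ q c
  have hball : (U ∩ Metric.ball q r).Nonempty := by
    have : q ∈ closure U := closure_minimal
      (hoseg ▸ h.openSegment_subset_closure hU ht) isClosed_closure hqcl
    obtain ⟨y, hy, hyd⟩ := Metric.mem_closure_iff.1 this r hr
    exact ⟨y, hy, by rwa [Metric.mem_ball, dist_comm]⟩
  have hUs : ∀ y ∈ U, y ∉ segment ℝ q c := fun y hy hys =>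
    hU.subset_compl hy (Set.mem_iUnion.2 ⟨k, hseg ▸ hys⟩)
  -- The slit ball is connected, and by `hno` the closure of `U` gains no point in it beyond `U`. So
  -- `U` swallows the slit ball, although the segment `l₀` enters it.
  have hsub : Metric.ball q r \ segment ℝ q c ⊆ U := by
    refine (isPreconnected_ball_diff_segment hcq hrc).subset_of_closure_inter_subset hU.isOpen ?_ ?_
    · obtain ⟨y, hyU, hyb⟩ := hball
      exact ⟨y, ⟨hyb, hUs y hyU⟩, hyU⟩
    · rintro y ⟨hyU, hyb, hys⟩
      rcases hU.closure_subset hS hyU with hy | hy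
      · exact hy
      · exfalso
        obtain ⟨l, hl⟩ := Set.mem_iUnion.1 hy
        have hlk : l ≠ k := by rintro rfl; exact hys (hseg ▸ hl)
        have hql : q ∈ segment ℝ (a l) (b l) := by
          by_contra hql
          exact Set.disjoint_left.1 (hfar l hql) hyb hl
        have hyq : y ≠ q := by rintro rfl; exact hys (left_mem_segment ℝ _ _)
        refine hno l hlk hql ⟨y, hyU, mem_openSegment_of_ne_left_right ?_ ?_ hl⟩
        · rintro rfl
          exact Set.disjoint_left.1 (hfa l hyq.symm) hyb rfl
        · rintro rfl
          exact Set.disjoint_left.1 (hfb l hyq.symm) hyb rfl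
  -- but the ball contains points of the segment `l₀`
  have hqo : q ∈ closure (openSegment ℝ (a l₀) (b l₀)) := by rwa [closure_openSegment]
  obtain ⟨y, hy, hyd⟩ := Metric.mem_closure_iff.1 hqo r hr
  have hyl := openSegment_subset_segment ℝ _ _ hy
  refine hU.subset_compl (hsub ⟨by rwa [Metric.mem_ball, dist_comm], fun hyk => ?_⟩)
    (Set.mem_iUnion.2 ⟨l₀, hyl⟩)
  rcases h.eq_end l₀ k hl₀ y hyl (hseg ▸ hyk) with rfl | rfl
  · exact h.ne l₀ (left_mem_openSegment_iff.1 hy)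
  · exact h.ne l₀ (right_mem_openSegment_iff.1 hy)

end IsSegmentFamily

/-! ### Winding numbers -/

/-- The winding number, up to the factor `2πi`, of a weighted family of segments. -/
noncomputable def winding {K : Type*} [Fintype K] (a b : K → ℂ) (z : K → ℂ) (p : ℂ) : ℂ :=
  ∑ k, z k * Complex.log ((b k - p) / (a k - p))

theorem notMem_segment_of_notMem_segmentUnion {K : Type*} {a b : K → ℂ} {p : ℂ}
    (hp : p ∉ segmentUnion a b) (k : K) : p ∉ segment ℝ (a k) (b k) :=
  fun h => hp (Set.mem_iUnion.2 ⟨k, h⟩)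

/-- The sum in `hz` is the derivative of the winding number at `p`. -/
theorem IsFace.winding_eq {K : Type*} [Fintype K] {a b : K → ℂ} {U : Set ℂ}
    (hU : IsFace (segmentUnion a b) U) {z : K → ℂ}
    (hz : ∀ p, ∑ k, z k * ((a k - p)⁻¹ - (b k - p)⁻¹) = 0) {x y : ℂ} (hx : x ∈ U) (hy : y ∈ U) :
    winding a b z x = winding a b z y := by
  have hd : ∀ p ∈ U, HasDerivAt (winding a b z) 0 p := by
    intro p hp
    have := HasDerivAt.fun_sum (u := Finset.univ) fun k _ => (hasDerivAt_log_sub_div_sub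
      (notMem_segment_of_notMem_segmentUnion (hU.subset_compl hp) k)).const_mul (z k)
    rw [hz p] at this
    exact this
  exact hU.isOpen.is_const_of_deriv_eq_zero hU.isPreconnected
    (fun p hp => (hd p hp).differentiableAt.differentiableWithinAt)
    (fun p hp => (hd p hp).deriv) hx hy

open Filter Topology in
/-- The winding number jumps by `2πi z k` across the segment `k`. -/
theorem IsSegmentFamily.eq_zero_of_winding_eq_zero {K : Type*} [Fintype K] {a b : K → ℂ}
    (h : IsSegmentFamily a b) {z : K → ℂ} {k : K}
    (h0 : ∀ U, IsFace (segmentUnion a b) U → Touches U (a k) (b k) →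
      ∀ x ∈ U, winding a b z x = 0) : z k = 0 := by
  classical
  set m : ℂ := midpoint ℝ (a k) (b k) with hm
  have hmo : m ∈ openSegment ℝ (a k) (b k) := midpoint_mem_openSegment _ _
  have hms : sideOf (a k) (b k) m = 0 :=
    sideOf_eq_zero (h.ne k) (openSegment_subset_segment ℝ _ _ hmo)
  obtain ⟨r, hr, hL, hR, -⟩ := h.exists_halfBall hmo
  have hS := isClosed_segmentUnion a b
  have hwL : ∀ y ∈ halfBall (a k) (b k) m r, winding a b z y = 0 := by
    intro y hy
    obtain ⟨U, hU, hs⟩ := exists_isFace_superset hS (isPreconnected_halfBall _ _ _ _) ⟨y, hy⟩ hL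
    exact h0 U hU ⟨m, closure_mono hs (mem_closure_halfBall (h.ne k) (Metric.mem_ball_self hr) hms),
      hmo⟩ y (hs hy)
  have hwR : ∀ y ∈ halfBall (b k) (a k) m r, winding a b z y = 0 := by
    intro y hy
    obtain ⟨U, hU, hs⟩ := exists_isFace_superset hS (isPreconnected_halfBall _ _ _ _) ⟨y, hy⟩ hR
    exact h0 U hU ⟨m, closure_mono hs (mem_closure_halfBall (h.ne k).symm (Metric.mem_ball_self hr)
      (by rw [sideOf_swap (h.ne k), hms, neg_zero])), hmo⟩ y (hs hy)
  -- This path crosses the segment at right angles in its midpoint. Only the logarithm of segment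
  -- `k` jumps there; the sum `R` of the others is continuous.
  let γ : ℝ → ℂ := fun t => m + t * (Complex.I * (b k - a k))
  have hγc : Continuous γ := by fun_prop
  have hγ0 : γ 0 = m := by simp [γ]
  have hγ : Tendsto γ (𝓝 0) (𝓝 m) := hγ0 ▸ hγc.tendsto 0
  let R : ℂ → ℂ := fun p => ∑ l ∈ Finset.univ.erase k, z l * Complex.log ((b l - p) / (a l - p))
  have hRc : ContinuousAt R m := by
    refine tendsto_finsetSum _ fun l hl => ?_
    have hml : m ∉ segment ℝ (a l) (b l) := by
      intro hml
      rcases h.eq_end k l (Finset.ne_of_mem_erase hl).symm m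
        (openSegment_subset_segment ℝ _ _ hmo) hml with e | e
      · exact h.ne k (left_mem_openSegment_iff.1 (e ▸ hmo))
      · exact h.ne k (right_mem_openSegment_iff.1 (e ▸ hmo))
    exact ((hasDerivAt_log_sub_div_sub hml).continuousAt.const_mul (z l))
  have hRγ : Tendsto (fun t => R (γ t)) (𝓝 0) (𝓝 (R m)) := hRc.tendsto.comp hγ
  have hsplit : ∀ p, winding a b z p = z k * Complex.log ((b k - p) / (a k - p)) + R p := fun p =>
    (Finset.add_sum_erase _ _ (Finset.mem_univ k)).symm
  have hba : b k - a k ≠ 0 := sub_ne_zero.2 (h.ne k).symm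
  -- The ratio moves on the unit circle through `-1`, its imaginary part having the sign of `t`, so
  -- its logarithm tends to `πi` from one side and to `-πi` from the other.
  have hq : ∀ t : ℝ, (b k - γ t) / (a k - γ t) =
      (((4 * t ^ 2 - 1) / (4 * t ^ 2 + 1) : ℝ) : ℂ) +
        ((4 * t / (4 * t ^ 2 + 1) : ℝ) : ℂ) * Complex.I := by
    intro t
    have h1 : a k - γ t = (b k - a k) * (-(1 / 2) - t * Complex.I) := by
      simp only [γ, hm, midpoint_eq_smul_add, Complex.real_smul, invOf_eq_inv]; push_cast; ring
    have h2 : b k - γ t = (b k - a k) * ((1 / 2) - t * Complex.I) := by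
      simp only [γ, hm, midpoint_eq_smul_add, Complex.real_smul, invOf_eq_inv]; push_cast; ring
    have h3 : (-(1 / 2) - t * Complex.I : ℂ) ≠ 0 := by
      intro e
      have := congrArg Complex.re e
      norm_num at this
    have h4 : (4 * t ^ 2 + 1 : ℂ) ≠ 0 := by
      have : (4 * t ^ 2 + 1 : ℝ) ≠ 0 := by positivity
      exact_mod_cast this
    have h5 : (((4 * t ^ 2 - 1) / (4 * t ^ 2 + 1) : ℝ) : ℂ) +
        ((4 * t / (4 * t ^ 2 + 1) : ℝ) : ℂ) * Complex.I =
        (4 * t ^ 2 - 1 + 4 * t * Complex.I) / (4 * t ^ 2 + 1) := by push_cast; ring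
    rw [h1, h2, mul_div_mul_left _ _ hba, h5, div_eq_div_iff h3 h4]
    linear_combination 4 * (t : ℂ) ^ 2 * Complex.I_sq
  have hqt : Tendsto (fun t : ℝ => (b k - γ t) / (a k - γ t)) (𝓝 0) (𝓝 (-1)) := by
    have hc : Continuous fun t : ℝ => (b k - γ t) / (a k - γ t) := by
      simp only [hq]
      have : ∀ t : ℝ, 4 * t ^ 2 + 1 ≠ 0 := fun t => by positivity
      fun_prop (disch := assumption)
    have := hc.tendsto 0
    rwa [hq 0, show ((((4 * 0 ^ 2 - 1) / (4 * 0 ^ 2 + 1) : ℝ) : ℂ) +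
      ((4 * 0 / (4 * 0 ^ 2 + 1) : ℝ) : ℂ) * Complex.I) = -1 by norm_num] at this
  have hqim : ∀ t : ℝ, ((b k - γ t) / (a k - γ t)).im = 4 * t / (4 * t ^ 2 + 1) := by
    intro t
    rw [hq t]
    simp only [Complex.add_im, Complex.ofReal_im, Complex.im_ofReal_mul, Complex.I_im]
    ring
  have hγside : ∀ t : ℝ, sideOf (a k) (b k) (γ t) = t := fun t => by
    rw [sideOf_add (h.ne k), hms, zero_add]
  have hlogR : Tendsto (fun t : ℝ => Complex.log ((b k - γ t) / (a k - γ t))) (𝓝[>] 0)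
      (𝓝 (Real.pi * Complex.I)) := by
    have h1 := Complex.tendsto_log_nhdsWithin_im_nonneg_of_re_neg_of_im_zero
      (z := -1) (by norm_num) (by norm_num)
    simp only [norm_neg, norm_one, Real.log_one, Complex.ofReal_zero, zero_add] at h1
    refine h1.comp (tendsto_nhdsWithin_iff.2 ⟨hqt.mono_left nhdsWithin_le_nhds, ?_⟩)
    filter_upwards [self_mem_nhdsWithin] with t ht
    have : (0 : ℝ) < t := ht
    change 0 ≤ Complex.im _
    rw [hqim]; positivity
  have hlogL : Tendsto (fun t : ℝ => Complex.log ((b k - γ t) / (a k - γ t))) (𝓝[<] 0)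
      (𝓝 (-(Real.pi * Complex.I))) := by
    have h1 := Complex.tendsto_log_nhdsWithin_im_neg_of_re_neg_of_im_zero
      (z := -1) (by norm_num) (by norm_num)
    simp only [norm_neg, norm_one, Real.log_one, Complex.ofReal_zero, zero_sub] at h1
    refine h1.comp (tendsto_nhdsWithin_iff.2 ⟨hqt.mono_left nhdsWithin_le_nhds, ?_⟩)
    filter_upwards [self_mem_nhdsWithin] with t ht
    have : t < 0 := ht
    change Complex.im _ < 0
    rw [hqim]; exact div_neg_of_neg_of_pos (by linarith) (by positivity)
  have hnear : ∀ᶠ t in 𝓝 (0 : ℝ), γ t ∈ Metric.ball m r := hγ (Metric.ball_mem_nhds m hr)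
  have e1 : z k * (Real.pi * Complex.I) + R m = 0 := by
    refine tendsto_nhds_unique ((hlogR.const_mul (z k)).add (hRγ.mono_left nhdsWithin_le_nhds))
      (tendsto_const_nhds.congr' ?_)
    filter_upwards [nhdsWithin_le_nhds hnear, self_mem_nhdsWithin] with t ht ht0
    rw [← hsplit, hwL _ ⟨ht, ?_⟩]
    change 0 < sideOf _ _ _
    rw [hγside]; exact ht0
  have e2 : z k * (-(Real.pi * Complex.I)) + R m = 0 := by
    refine tendsto_nhds_unique ((hlogL.const_mul (z k)).add (hRγ.mono_left nhdsWithin_le_nhds))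
      (tendsto_const_nhds.congr' ?_)
    filter_upwards [nhdsWithin_le_nhds hnear, self_mem_nhdsWithin] with t ht ht0
    rw [← hsplit, hwR _ ⟨ht, ?_⟩]
    change 0 < sideOf _ _ _
    rw [sideOf_swap (h.ne k), hγside]; exact neg_pos.2 ht0
  have hpi : (2 * (Real.pi * Complex.I) : ℂ) ≠ 0 := by
    simp [Real.pi_ne_zero]
  have e3 : z k * (2 * (Real.pi * Complex.I)) = 0 := by linear_combination e1 - e2
  exact (mul_eq_zero.1 e3).resolve_right hpi

/-! ### Simple polygonal curves and simple drawings -/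

/-- `x` and `y` are joined inside `S` by a polygonal curve of `n` segments. -/
def IsJoinedBySegments (S : Set ℂ) (n : ℕ) (x y : ℂ) : Prop :=
  ∃ p : ℕ → ℂ, p 0 = x ∧ p n = y ∧ ∀ i < n, segment ℝ (p i) (p (i + 1)) ⊆ S

theorem IsJoinedBySegments.trans {S : Set ℂ} {m n : ℕ} {x y z : ℂ}
    (h₁ : IsJoinedBySegments S m x y) (h₂ : IsJoinedBySegments S n y z) :
    IsJoinedBySegments S (m + n) x z := by
  obtain ⟨p, hp0, hpm, hp⟩ := h₁
  obtain ⟨q, hq0, hqn, hq⟩ := h₂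
  refine ⟨fun i => if i ≤ m then p i else q (i - m), by simp [hp0], ?_, fun i hi => ?_⟩
  · rcases Nat.eq_zero_or_pos n with rfl | hn
    · simp [hpm, ← hq0, hqn]
    · simp [hn.ne', hqn]
  · dsimp only
    rcases lt_trichotomy i m with h | rfl | h
    · rw [if_pos h.le, if_pos (by lia)]
      exact hp i h
    · rw [if_pos le_rfl, if_neg (by lia), hpm, ← hq0, show i + 1 - i = 0 + 1 by lia]
      exact hq 0 (by lia)
    · rw [if_neg (by lia), if_neg (by lia), show i + 1 - m = i - m + 1 by lia]
      exact hq (i - m) (by lia)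

theorem isJoinedBySegments_one {S : Set ℂ} {x y : ℂ} (h : segment ℝ x y ⊆ S) :
    IsJoinedBySegments S 1 x y :=
  ⟨fun i => if i = 0 then x else y, rfl, rfl, fun i hi => by
    obtain rfl : i = 0 := by lia
    exact h⟩

theorem isJoinedBySegments_of_chain {S : Set ℂ} {n : ℕ} {p : ℕ → ℂ}
    (hp : ∀ i < n, segment ℝ (p i) (p (i + 1)) ⊆ S) {i j : ℕ} (hij : i ≤ j) (hj : j ≤ n) :
    IsJoinedBySegments S (j - i) (p i) (p j) :=
  ⟨fun m => p (i + m), rfl, by simp [hij], fun m hm => hp (i + m) (by lia)⟩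

/-- A curve of fewest segments is simple. -/
theorem IsJoinedBySegments.exists_simple {S : Set ℂ} {N : ℕ} {x y : ℂ}
    (h : IsJoinedBySegments S N x y) :
    ∃ (n : ℕ) (p : ℕ → ℂ), p 0 = x ∧ p n = y ∧ (∀ i < n, segment ℝ (p i) (p (i + 1)) ⊆ S) ∧
      (∀ i < n, p i ≠ p (i + 1)) ∧
      ∀ i j, i < j → j < n → ∀ w ∈ segment ℝ (p i) (p (i + 1)),
        w ∈ segment ℝ (p j) (p (j + 1)) → j = i + 1 ∧ w = p (i + 1) := by
  classical
  have hex : ∃ n, IsJoinedBySegments S n x y := ⟨N, h⟩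
  obtain ⟨p, hp0, hpn, hp⟩ := Nat.find_spec hex
  set n := Nat.find hex with hn
  have hmin : ∀ m, IsJoinedBySegments S m x y → n ≤ m := fun m hm => Nat.find_min' hex hm
  -- no shortcuts
  have hcut : ∀ i j m, i ≤ j → j ≤ n → IsJoinedBySegments S m (p i) (p j) → j ≤ i + m := by
    intro i j m hij hj hm
    have h1 := (isJoinedBySegments_of_chain hp (Nat.zero_le i) (hij.trans hj)).trans
      (hm.trans (isJoinedBySegments_of_chain hp hj le_rfl))
    rw [hp0, hpn] at h1
    have := hmin _ h1
    lia
  refine ⟨n, p, hp0, hpn, hp, fun i hi e => ?_, fun i j hij hj w hwi hwj => ?_⟩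
  · have := hcut i (i + 1) 0 (by lia) hi ⟨fun _ => p i, rfl, e, fun _ h => absurd h (by lia)⟩
    lia
  -- The detour `p i`, `w`, `p (j + 1)` has two segments, so minimality forces `j + 1 ≤ i + 2`.
  · have h1 : IsJoinedBySegments S 2 (p i) (p (j + 1)) :=
      (isJoinedBySegments_one (((convex_segment _ _).segment_subset (left_mem_segment ℝ _ _)
        hwi).trans (hp i (by lia)))).trans
      (isJoinedBySegments_one (((convex_segment _ _).segment_subset hwj (right_mem_segment ℝ _ _)
        ).trans (hp j hj)))
    have hji : j = i + 1 := by
      have := hcut i (j + 1) 2 (by lia) (by lia) h1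
      lia
    subst hji
    refine ⟨rfl, ?_⟩
    -- Otherwise both segments leave `p (i + 1)` in the same direction. One then contains the other,
    -- and a single segment joins `p i` to `p (i + 2)`.
    by_contra hw
    have w1 : Wbtw ℝ (p (i + 1)) w (p i) := by
      rw [← mem_segment_iff_wbtw, segment_symm]; exact hwi
    have w2 : Wbtw ℝ (p (i + 1)) w (p (i + 1 + 1)) := mem_segment_iff_wbtw.1 hwj
    have hray : SameRay ℝ (p i -ᵥ p (i + 1)) (p (i + 1 + 1) -ᵥ p (i + 1)) :=
      w1.sameRay_vsub_left.symm.trans w2.sameRay_vsub_left fun h0 =>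
        absurd (vsub_eq_zero_iff_eq.1 h0) hw
    have hseg : segment ℝ (p i) (p (i + 1 + 1)) ⊆ S := by
      rcases wbtw_total_of_sameRay_vsub_left hray with h2 | h2
      · exact ((convex_segment _ _).segment_subset (mem_segment_iff_wbtw.2 h2)
          (right_mem_segment ℝ _ _)).trans (hp (i + 1) hj)
      · have h3 := mem_segment_iff_wbtw.2 h2
        rw [segment_symm] at h3
        exact ((convex_segment _ _).segment_subset (left_mem_segment ℝ _ _) h3).trans
          (hp i (by lia))
    have := hcut i (i + 1 + 1) 1 (by lia) (by lia) (isJoinedBySegments_one hseg)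
    lia

/-- A crossing-free drawing of `G` in which the edge `e`, directed from `tail e` to `head e`, is
the simple polygonal curve with corners `p e 0, …, p e (n e)`. -/
structure IsSimpleDrawing {V : Type*} (G : SimpleGraph V) (P : V → ℂ) (tail head : G.edgeSet → V)
    (n : G.edgeSet → ℕ) (p : G.edgeSet → ℕ → ℂ) : Prop where
  injective : Function.Injective P
  edge_eq : ∀ e : G.edgeSet, (e : Sym2 V) = s(tail e, head e)
  start : ∀ e, p e 0 = P (tail e)
  finish : ∀ e, p e (n e) = P (head e)
  ne : ∀ e, ∀ i < n e, p e i ≠ p e (i + 1)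
  simple : ∀ e i j, i < j → j < n e → ∀ x ∈ segment ℝ (p e i) (p e (i + 1)),
    x ∈ segment ℝ (p e j) (p e (j + 1)) → j = i + 1 ∧ x = p e (i + 1)
  no_crossing : ∀ e f, e ≠ f → ∀ i < n e, ∀ j < n f, ∀ x ∈ segment ℝ (p e i) (p e (i + 1)),
    x ∈ segment ℝ (p f j) (p f (j + 1)) →
      ∃ w : V, w ∈ (e : Sym2 V) ∧ w ∈ (f : Sym2 V) ∧ x = P w
  mem_of_mem : ∀ e, ∀ i < n e, ∀ w, P w ∈ segment ℝ (p e i) (p e (i + 1)) → w ∈ (e : Sym2 V)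

/-- A given curve may cross itself. A curve of fewest segments within it does not, and as a subset
it creates no new crossings. -/
theorem SimpleGraph.IsPlanar.exists_isSimpleDrawing {V : Type*} {G : SimpleGraph V}
    (hG : G.IsPlanar) : ∃ P tail head n p, IsSimpleDrawing G P tail head n p := by
  obtain ⟨point, curve, h⟩ := hG
  let φ : ℂ ≃ₗᵢ[ℝ] Plane := Complex.orthonormalBasisOneI.repr
  have hends : ∀ e : G.edgeSet, ∃ u v : V, (e : Sym2 V) = s(u, v) := by
    rintro ⟨e, he⟩
    induction e with | _ u v => exact ⟨u, v, rfl⟩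
  choose tail head hth using hends
  have hch : ∀ e : G.edgeSet, ∃ (n : ℕ) (p : ℕ → ℂ), p 0 = φ.symm (point (tail e)) ∧
      p n = φ.symm (point (head e)) ∧
      (∀ i < n, segment ℝ (p i) (p (i + 1)) ⊆ φ ⁻¹' (curve e)) ∧
      (∀ i < n, p i ≠ p (i + 1)) ∧
      ∀ i j, i < j → j < n → ∀ w ∈ segment ℝ (p i) (p (i + 1)),
        w ∈ segment ℝ (p j) (p (j + 1)) → j = i + 1 ∧ w = p (i + 1) := by
    intro e
    have hadj : G.Adj (tail e) (head e) := by
      rw [← SimpleGraph.mem_edgeSet, ← hth e]; exact e.2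
    obtain ⟨n, p, hp0, hpn, hS⟩ := h.isPolygonalCurve _ _ hadj
    have he : (⟨s(tail e, head e), hadj⟩ : G.edgeSet) = e := Subtype.ext (hth e).symm
    rw [he] at hS
    refine IsJoinedBySegments.exists_simple (N := n) ⟨fun i => φ.symm (p i), ?_, ?_, ?_⟩
    · simp [hp0]
    · simp [hpn]
    · intro i hi x hx
      rw [Set.mem_preimage, hS]
      refine Set.mem_iUnion₂.2 ⟨i, hi, ?_⟩
      obtain ⟨s, t, hs, ht, hst, rfl⟩ := hx
      exact ⟨s, t, hs, ht, hst, by simp only [map_add, map_smul, φ.apply_symm_apply]⟩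
  choose n p hp0 hpn hpS hne hsimple using hch
  refine ⟨fun v => φ.symm (point v), tail, head, n, p,
    φ.symm.injective.comp h.point_injective, hth, hp0, hpn, hne, hsimple, ?_, ?_⟩
  · intro e f hef i hi j hj x hxe hxf
    obtain ⟨w, hwe, hwf, hx⟩ := h.no_crossing e f hef (φ x) ⟨hpS e i hi hxe, hpS f j hj hxf⟩
    exact ⟨w, hwe, hwf, by simp [← hx]⟩
  · intro e i hi w hw
    exact h.mem_of_point_mem e w (by simpa using hpS e i hi hw)

namespace IsSimpleDrawing

variable {V : Type*} {G : SimpleGraph V} {P : V → ℂ} {tail head : G.edgeSet → V}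
  {n : G.edgeSet → ℕ} {p : G.edgeSet → ℕ → ℂ}

theorem tail_ne_head (h : IsSimpleDrawing G P tail head n p) (e : G.edgeSet) :
    tail e ≠ head e := by
  have : G.Adj (tail e) (head e) := by
    rw [← SimpleGraph.mem_edgeSet, ← h.edge_eq e]; exact e.2
  exact this.ne

theorem length_pos (h : IsSimpleDrawing G P tail head n p) (e : G.edgeSet) : 0 < n e := by
  rw [Nat.pos_iff_ne_zero]
  intro h0
  have := h.finish e
  rw [h0, h.start e] at this
  exact h.tail_ne_head e (h.injective this)

theorem eq_zero_of_start_mem (h : IsSimpleDrawing G P tail head n p) {e : G.edgeSet} {i : ℕ}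
    (hi : i < n e) (hm : p e 0 ∈ segment ℝ (p e i) (p e (i + 1))) : i = 0 := by
  by_contra h0
  exact h.ne e 0 (by lia)
    (h.simple e 0 i (by lia) hi _ (left_mem_segment ℝ _ _) hm).2

theorem eq_of_finish_mem (h : IsSimpleDrawing G P tail head n p) {e : G.edgeSet} {i : ℕ}
    (hi : i < n e) (hm : p e (n e) ∈ segment ℝ (p e i) (p e (i + 1))) : i + 1 = n e := by
  by_contra h0
  have hlast : p e (n e) ∈ segment ℝ (p e (n e - 1)) (p e (n e - 1 + 1)) := by
    rw [Nat.sub_add_cancel (by lia)]; exact right_mem_segment ℝ _ _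
  obtain ⟨h1, h2⟩ := h.simple e i (n e - 1) (by lia) (by lia) _ hm hlast
  refine h.ne e (n e - 1) (by lia) ?_
  rw [Nat.sub_add_cancel (by lia), h2, h1]

theorem eq_or_eq_of_corner_mem (h : IsSimpleDrawing G P tail head n p) {e : G.edgeSet} {i j : ℕ}
    (hi : i + 1 < n e) (hj : j < n e) (hm : p e (i + 1) ∈ segment ℝ (p e j) (p e (j + 1))) :
    j = i ∨ j = i + 1 := by
  rcases lt_trichotomy j i with hji | rfl | hji
  · obtain ⟨h1, h2⟩ := h.simple e j i hji (by lia) _ hm (right_mem_segment ℝ _ _)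
    subst h1
    exact absurd h2.symm (h.ne e (j + 1) (by lia))
  · exact Or.inl rfl
  · exact Or.inr (h.simple e i j hji hj _ (right_mem_segment ℝ _ _) hm).1

/-- A vertex on an edge is its start or its finish. -/
theorem eq_start_or_eq_finish (h : IsSimpleDrawing G P tail head n p) {e : G.edgeSet} {w : V}
    (hw : w ∈ (e : Sym2 V)) : P w = p e 0 ∨ P w = p e (n e) := by
  rw [h.edge_eq e, Sym2.mem_iff] at hw
  rcases hw with rfl | rfl
  · exact Or.inl (h.start e).symm
  · exact Or.inr (h.finish e).symm

/-- A point shared with another edge is a common vertex, hence the start or the finish of `e`, and a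
simple curve does not return there at an inner corner. -/
theorem mem_corner_unique (h : IsSimpleDrawing G P tail head n p) {e : G.edgeSet} {i : ℕ}
    (hi : i + 1 < n e)
    {f : G.edgeSet} {j : ℕ} (hj : j < n f)
    (hm : p e (i + 1) ∈ segment ℝ (p f j) (p f (j + 1))) : f = e := by
  by_contra hfe
  obtain ⟨w, hw, -, hx⟩ := h.no_crossing e f (Ne.symm hfe) i (by lia) j hj _
    (right_mem_segment ℝ _ _) hm
  rcases h.eq_start_or_eq_finish hw with h1 | h1
  · have h2 := h.eq_zero_of_start_mem (e := e) (i := i + 1) hi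
      (by rw [← h1, ← hx]; exact left_mem_segment ℝ _ _)
    lia
  · have h2 := h.eq_of_finish_mem (e := e) (i := i) (by lia)
      (by rw [← h1, ← hx]; exact right_mem_segment ℝ _ _)
    lia

theorem isSegmentFamily (h : IsSimpleDrawing G P tail head n p) :
    IsSegmentFamily (fun k : Σ e, Fin (n e) => p k.1 k.2) (fun k => p k.1 (k.2 + 1)) where
  ne k := h.ne k.1 k.2 k.2.2
  eq_end := by
    rintro ⟨e, i, hi⟩ ⟨f, j, hj⟩ hkl x hxe hxf
    dsimp only at *
    by_cases hef : e = f
    · subst hef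
      rcases lt_trichotomy i j with hij | rfl | hij
      · exact Or.inr (h.simple e i j hij hj x hxe hxf).2
      · exact absurd rfl hkl
      · obtain ⟨h1, h2⟩ := h.simple e j i hij hi x hxf hxe
        exact Or.inl (h1 ▸ h2)
    · obtain ⟨w, hwe, -, rfl⟩ := h.no_crossing e f hef i hi j hj x hxe hxf
      rcases h.eq_start_or_eq_finish hwe with hw | hw
      · rw [hw] at hxe ⊢
        rw [h.eq_zero_of_start_mem hi hxe]
        exact Or.inl rfl
      · rw [hw] at hxe ⊢
        rw [h.eq_of_finish_mem hi hxe]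
        exact Or.inr rfl

end IsSimpleDrawing

/-! ### Faces and edges of a drawing -/

/-- The point set of a drawing. -/
def drawingUnion {V : Type*} {G : SimpleGraph V} (n : G.edgeSet → ℕ) (p : G.edgeSet → ℕ → ℂ) :
    Set ℂ :=
  segmentUnion (fun k : Σ e, Fin (n e) => p k.1 k.2) (fun k => p k.1 (k.2 + 1))

/-- A face touches an edge if it touches one of its segments. -/
def TouchesEdge {V : Type*} {G : SimpleGraph V} (n : G.edgeSet → ℕ) (p : G.edgeSet → ℕ → ℂ)
    (U : Set ℂ) (e : G.edgeSet) : Prop :=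
  ∃ i < n e, Touches U (p e i) (p e (i + 1))

namespace IsSimpleDrawing

variable {V : Type*} {G : SimpleGraph V} [Finite G.edgeSet] {P : V → ℂ} {tail head : G.edgeSet → V}
  {n : G.edgeSet → ℕ} {p : G.edgeSet → ℕ → ℂ} {U : Set ℂ} {e : G.edgeSet}

/-- Only these two segments meet at the inner corner, so the further segment found by
`exists_touches_of_end` is the other one. -/
theorem touches_succ_iff (h : IsSimpleDrawing G P tail head n p) (hU : IsFace (drawingUnion n p) U)
    {i : ℕ} (hi : i + 1 < n e) :
    Touches U (p e i) (p e (i + 1)) ↔ Touches U (p e (i + 1)) (p e (i + 1 + 1)) := by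
  have hF := h.isSegmentFamily
  let k : Σ e, Fin (n e) := ⟨e, i, by lia⟩
  let k' : Σ e, Fin (n e) := ⟨e, i + 1, hi⟩
  have hkk : k ≠ k' := by simp [k, k']
  constructor
  · intro ht
    obtain ⟨⟨f, j, hj⟩, hne, hm, hl⟩ := hF.exists_touches_of_end (k := k) (l₀ := k')
      (q := p e (i + 1)) (c := p e i) (Or.inr ⟨rfl, rfl⟩) hU ht hkk.symm (left_mem_segment ℝ _ _)
    dsimp only at hm hl
    obtain rfl := h.mem_corner_unique hi hj hm
    rcases h.eq_or_eq_of_corner_mem hi hj hm with rfl | rfl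
    · exact absurd rfl hne
    · exact hl
  · intro ht
    obtain ⟨⟨f, j, hj⟩, hne, hm, hl⟩ := hF.exists_touches_of_end (k := k') (l₀ := k)
      (q := p e (i + 1)) (c := p e (i + 1 + 1)) (Or.inl ⟨rfl, rfl⟩) hU ht hkk
      (right_mem_segment ℝ _ _)
    dsimp only at hm hl
    obtain rfl := h.mem_corner_unique hi hj hm
    rcases h.eq_or_eq_of_corner_mem hi hj hm with rfl | rfl
    · exact hl
    · exact absurd rfl hne

theorem touches_of_touchesEdge (h : IsSimpleDrawing G P tail head n p)
    (hU : IsFace (drawingUnion n p) U) (ht : TouchesEdge n p U e) {i : ℕ} (hi : i < n e) :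
    Touches U (p e i) (p e (i + 1)) := by
  have key : ∀ i < n e, (Touches U (p e i) (p e (i + 1)) ↔ Touches U (p e 0) (p e (0 + 1))) := by
    intro i
    induction i with
    | zero => exact fun _ => Iff.rfl
    | succ i ih => exact fun hi => (h.touches_succ_iff hU hi).symm.trans (ih (by lia))
  obtain ⟨j, hj, ht⟩ := ht
  exact (key i hi).2 ((key j hj).1 ht)

/-- Only one segment of `e` contains `P v`, so the further segment touched at that point belongs to
another edge. The edge `f₀` excludes an end of degree one. -/
theorem exists_touchesEdge_of_mem (h : IsSimpleDrawing G P tail head n p)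
    (hU : IsFace (drawingUnion n p) U) (ht : TouchesEdge n p U e) {v : V} (hv : v ∈ (e : Sym2 V))
    {f₀ : G.edgeSet} (hf₀ : f₀ ≠ e) (hvf₀ : v ∈ (f₀ : Sym2 V)) :
    ∃ f ≠ e, v ∈ (f : Sym2 V) ∧ TouchesEdge n p U f := by
  have hF := h.isSegmentFamily
  have hpos := h.length_pos
  have hmem₀ : ∃ j, ∃ hj : j < n f₀, P v ∈ segment ℝ (p f₀ j) (p f₀ (j + 1)) := by
    rcases h.eq_start_or_eq_finish hvf₀ with h1 | h1
    · exact ⟨0, hpos f₀, h1 ▸ left_mem_segment ℝ _ _⟩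
    · refine ⟨n f₀ - 1, by have := hpos f₀; lia, ?_⟩
      rw [Nat.sub_add_cancel (hpos f₀), h1]
      exact right_mem_segment ℝ _ _
  obtain ⟨j₀, hj₀, hm₀⟩ := hmem₀
  rcases h.eq_start_or_eq_finish hv with h1 | h1
  · obtain ⟨⟨f, j, hj⟩, hne, hm, hl⟩ := hF.exists_touches_of_end (k := ⟨e, 0, hpos e⟩)
      (l₀ := ⟨f₀, j₀, hj₀⟩) (q := P v) (c := p e (0 + 1)) (Or.inl ⟨h1, rfl⟩) hU
      (h.touches_of_touchesEdge hU ht (hpos e)) (fun hk => hf₀ (congrArg Sigma.fst hk)) hm₀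
    refine ⟨f, ?_, h.mem_of_mem f j hj v hm, j, hj, hl⟩
    rintro rfl
    obtain rfl := h.eq_zero_of_start_mem hj (h1 ▸ hm)
    exact hne rfl
  · have hlast : n e - 1 < n e := by have := hpos e; lia
    obtain ⟨⟨f, j, hj⟩, hne, hm, hl⟩ := hF.exists_touches_of_end (k := ⟨e, n e - 1, hlast⟩)
      (l₀ := ⟨f₀, j₀, hj₀⟩) (q := P v) (c := p e (n e - 1))
      (Or.inr ⟨by dsimp only; rw [h1, Nat.sub_add_cancel (hpos e)], rfl⟩) hU
      (h.touches_of_touchesEdge hU ht hlast) (fun hk => hf₀ (congrArg Sigma.fst hk)) hm₀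
    refine ⟨f, ?_, h.mem_of_mem f j hj v hm, j, hj, hl⟩
    rintro rfl
    have := h.eq_of_finish_mem hj (h1 ▸ hm)
    obtain rfl : j = n f - 1 := by lia
    exact hne rfl

theorem exists_two_faces (h : IsSimpleDrawing G P tail head n p) (e : G.edgeSet) :
    ∃ U₁ U₂, ∀ U, IsFace (drawingUnion n p) U → TouchesEdge n p U e → U = U₁ ∨ U = U₂ := by
  obtain ⟨U₁, U₂, h12⟩ := h.isSegmentFamily.exists_two_faces ⟨e, 0, h.length_pos e⟩
  exact ⟨U₁, U₂, fun U hU ht => h12 U hU (h.touches_of_touchesEdge hU ht (h.length_pos e))⟩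

end IsSimpleDrawing

/-! ### The cycle space and the count of faces -/

/-- The boundary of a weighting of the edges, directed from `tail` to `head`. -/
def boundaryMap {V E : Type*} [Fintype E] [DecidableEq V] (tail head : E → V) :
    (E → ℂ) →ₗ[ℂ] (V → ℂ) where
  toFun z v := ∑ e, z e * ((if tail e = v then 1 else 0) - (if head e = v then 1 else 0))
  map_add' x y := by
    ext v
    simp only [Pi.add_apply, add_mul, Finset.sum_add_distrib]
  map_smul' c x := by
    ext v
    simp only [Pi.smul_apply, smul_eq_mul, mul_assoc, Finset.mul_sum, RingHom.id_apply]

/-- Used with `g = 1`, to see that boundaries have total weight zero, and with `g v = (P v - x)⁻¹`,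
to differentiate winding numbers. -/
theorem sum_boundaryMap_mul {V E : Type*} [Fintype V] [Fintype E] [DecidableEq V]
    (tail head : E → V) (z : E → ℂ) (g : V → ℂ) :
    ∑ v, boundaryMap tail head z v * g v = ∑ e, z e * (g (tail e) - g (head e)) := by
  simp only [boundaryMap, LinearMap.coe_mk, AddHom.coe_mk, Finset.sum_mul]
  rw [Finset.sum_comm]
  refine Finset.sum_congr rfl fun e _ => ?_
  simp only [mul_assoc, ← Finset.mul_sum, sub_mul, Finset.sum_sub_distrib, ite_mul, one_mul,
    zero_mul, Finset.sum_ite_eq, Finset.mem_univ, if_true]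

/-- The cycle space of a graph has dimension at least `|E| - |V| + 1`. -/
theorem card_add_one_le_finrank_ker_boundaryMap {V E : Type*} [Fintype V] [Fintype E]
    [DecidableEq V] [Nonempty V] (tail head : E → V) :
    Fintype.card E + 1 ≤
      Module.finrank ℂ (LinearMap.ker (boundaryMap tail head)) + Fintype.card V := by
  have h1 := (boundaryMap tail head).finrank_range_add_finrank_ker
  rw [Module.finrank_fintype_fun_eq_card] at h1
  have h2 : Module.finrank ℂ (LinearMap.range (boundaryMap tail head)) < Fintype.card V := by
    rw [← Module.finrank_fintype_fun_eq_card (R := ℂ) (η := V)]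
    refine Submodule.finrank_lt ?_
    intro htop
    obtain ⟨v⟩ := ‹Nonempty V›
    have : Pi.single v (1 : ℂ) ∈ LinearMap.range (boundaryMap tail head) := htop ▸ trivial
    obtain ⟨z, hz⟩ := this
    have h3 := sum_boundaryMap_mul tail head z 1
    simp [hz] at h3
  lia

namespace IsSimpleDrawing

variable {V : Type*} [Fintype V] {G : SimpleGraph V} {P : V → ℂ}
  {tail head : G.edgeSet → V} {n : G.edgeSet → ℕ} {p : G.edgeSet → ℕ → ℂ}

/-- Along each edge the sum telescopes to a difference between its ends. This is the hypothesis of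
`IsFace.winding_eq`. -/
theorem sum_segments_eq_zero [Fintype G.edgeSet] [DecidableEq V]
    (h : IsSimpleDrawing G P tail head n p) {z : G.edgeSet → ℂ} (hz : boundaryMap tail head z = 0) (x : ℂ) :
    ∑ k : Σ e, Fin (n e), z k.1 * ((p k.1 k.2 - x)⁻¹ - (p k.1 (k.2 + 1) - x)⁻¹) = 0 := by
  have h1 := sum_boundaryMap_mul tail head z fun v => (P v - x)⁻¹
  simp only [hz, Pi.zero_apply, zero_mul, Finset.sum_const_zero] at h1
  rw [Fintype.sum_sigma, h1]
  refine Finset.sum_congr rfl fun e _ => ?_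
  dsimp only
  rw [← Finset.mul_sum, Fin.sum_univ_eq_sum_range
    (fun i => (p e i - x)⁻¹ - (p e (i + 1) - x)⁻¹) (n e), Finset.sum_range_sub', h.start, h.finish]

/-- The faces touching at least one edge. -/
def touchingFaces (n : G.edgeSet → ℕ) (p : G.edgeSet → ℕ → ℂ) : Set (Set ℂ) :=
  {U | IsFace (drawingUnion n p) U ∧ ∃ e, TouchesEdge n p U e}

theorem finite_touchingFaces (h : IsSimpleDrawing G P tail head n p) :
    (touchingFaces n p).Finite := by
  choose U₁ U₂ h12 using h.exists_two_faces
  refine ((Set.finite_range U₁).union (Set.finite_range U₂)).subset ?_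
  rintro U ⟨hU, e, he⟩
  rcases h12 e U hU he with rfl | rfl
  · exact Or.inl ⟨e, rfl⟩
  · exact Or.inr ⟨e, rfl⟩

/-- The cycle space embeds into the functions on the faces. -/
theorem finrank_ker_boundaryMap_le [Fintype G.edgeSet] [DecidableEq V]
    (h : IsSimpleDrawing G P tail head n p) :
    Module.finrank ℂ (LinearMap.ker (boundaryMap tail head)) ≤ (touchingFaces n p).ncard := by
  classical
  have := h.finite_touchingFaces.fintype
  choose pt hpt using fun U : touchingFaces n p => U.2.1.nonempty
  let W : (G.edgeSet → ℂ) →ₗ[ℂ] (touchingFaces n p → ℂ) :=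
    { toFun := fun z U => winding (fun k : Σ e, Fin (n e) => p k.1 k.2) (fun k => p k.1 (k.2 + 1))
        (fun k => z k.1) (pt U)
      map_add' := fun x y => by
        ext U
        simp only [winding, Pi.add_apply, add_mul, Finset.sum_add_distrib]
      map_smul' := fun c x => by
        ext U
        simp only [winding, Pi.smul_apply, smul_eq_mul, mul_assoc, Finset.mul_sum,
          RingHom.id_apply] }
  -- If the winding number vanishes on every face touching `e`, the jump across the first segment of
  -- `e` gives `z e = 0`.
  have hinj : Function.Injective (W.domRestrict (LinearMap.ker (boundaryMap tail head))) := by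
    rw [← LinearMap.ker_eq_bot, LinearMap.ker_eq_bot']
    rintro ⟨z, hz⟩ hW
    ext e
    refine h.isSegmentFamily.eq_zero_of_winding_eq_zero (z := fun k => z k.1)
      (k := ⟨e, 0, h.length_pos e⟩) fun U hU ht x hx => ?_
    let U' : touchingFaces n p := ⟨U, hU, e, 0, h.length_pos e, ht⟩
    rw [hU.winding_eq (h.sum_segments_eq_zero hz) hx (hpt U')]
    exact congrFun hW U'
  have := LinearMap.finrank_le_finrank_of_injective hinj
  rwa [Module.finrank_fintype_fun_eq_card, ← Nat.card_eq_fintype_card,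
    Nat.card_coe_set_eq] at this

/-- Every face touches at least three edges, and every edge is touched by at most two faces. -/
theorem three_mul_ncard_touchingFaces_le [Fintype G.edgeSet]
    (h : IsSimpleDrawing G P tail head n p)
    (hdeg : ∀ (e : G.edgeSet) (v : V), v ∈ (e : Sym2 V) →
      ∃ f : G.edgeSet, f ≠ e ∧ v ∈ (f : Sym2 V)) :
    (touchingFaces n p).ncard * 3 ≤ Fintype.card G.edgeSet * 2 := by
  classical
  rw [Set.ncard_eq_toFinset_card _ h.finite_touchingFaces, ← Finset.card_univ]
  refine Finset.card_mul_le_card_mul (fun U e => TouchesEdge n p U e) ?_ ?_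
  · intro U hU
    obtain ⟨hU, e, he⟩ := h.finite_touchingFaces.mem_toFinset.1 hU
    have ht : tail e ∈ (e : Sym2 V) := by rw [h.edge_eq e]; exact Sym2.mem_mk_left _ _
    have hh : head e ∈ (e : Sym2 V) := by rw [h.edge_eq e]; exact Sym2.mem_mk_right _ _
    obtain ⟨f₀, hf₀, hf₀'⟩ := hdeg e _ ht
    obtain ⟨g₀, hg₀, hg₀'⟩ := hdeg e _ hh
    obtain ⟨f, hfe, htf, hf⟩ := h.exists_touchesEdge_of_mem hU he ht hf₀ hf₀'
    obtain ⟨g, hge, hhg, hg⟩ := h.exists_touchesEdge_of_mem hU he hh hg₀ hg₀'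
    -- An edge through both ends of `e` is `e` itself, as the graph is simple.
    have hfg : f ≠ g := by
      rintro rfl
      refine hfe (Subtype.ext ?_)
      rw [h.edge_eq e]
      exact (Sym2.mem_and_mem_iff (h.tail_ne_head e)).1 ⟨htf, hhg⟩
    rw [show 3 = ({e, f, g} : Finset G.edgeSet).card by
      rw [Finset.card_eq_three.2 ⟨e, f, g, hfe.symm, hge.symm, hfg, rfl⟩]]
    refine Finset.card_le_card fun x hx => ?_
    simp only [Finset.mem_insert, Finset.mem_singleton] at hx
    rw [Finset.mem_bipartiteAbove]
    refine ⟨Finset.mem_univ _, ?_⟩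
    rcases hx with rfl | rfl | rfl <;> assumption
  · intro e _
    obtain ⟨U₁, U₂, h12⟩ := h.exists_two_faces e
    refine (Finset.card_le_card (t := {U₁, U₂}) fun U hU => ?_).trans Finset.card_le_two
    rw [Finset.mem_bipartiteBelow] at hU
    simpa using h12 U (h.finite_touchingFaces.mem_toFinset.1 hU.1).1 hU.2

end IsSimpleDrawing

/-! ### Vertices of small degree in planar graphs -/

namespace SimpleGraph

/-- A planar graph without vertices of degree less than two has fewer than `3 |V|` edges. -/
theorem IsPlanar.card_edgeSet_lt {V : Type*} [Fintype V] [Nonempty V] {G : SimpleGraph V}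
    [Fintype G.edgeSet] (hG : G.IsPlanar)
    (hdeg : ∀ (e : G.edgeSet) (v : V), v ∈ (e : Sym2 V) →
      ∃ f : G.edgeSet, f ≠ e ∧ v ∈ (f : Sym2 V)) :
    Fintype.card G.edgeSet < 3 * Fintype.card V := by
  classical
  obtain ⟨P, tail, head, n, p, h⟩ := hG.exists_isSimpleDrawing
  have h1 := card_add_one_le_finrank_ker_boundaryMap tail head
  have h2 := h.finrank_ker_boundaryMap_le
  have h3 := h.three_mul_ncard_touchingFaces_le hdeg
  lia

theorem IsPlanar.of_injective_hom {V W : Type*} {G : SimpleGraph V} {G' : SimpleGraph W}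
    (hG : G.IsPlanar) (f : G' →g G) (hf : Function.Injective f) : G'.IsPlanar := by
  obtain ⟨point, curve, h⟩ := hG
  refine ⟨point ∘ f, fun e => curve (f.mapEdgeSet e), h.point_injective.comp hf,
    fun u v huv => h.isPolygonalCurve _ _ (f.map_adj huv), fun e w hw => ?_, ?_⟩
  · obtain ⟨w', hw', e'⟩ := Sym2.mem_map.1 (h.mem_of_point_mem _ _ hw)
    exact hf e' ▸ hw'
  · rintro e e' hee x hx
    obtain ⟨w, hw, hw', rfl⟩ := h.no_crossing _ _
      (fun hc => hee (Hom.mapEdgeSet.injective f hf hc)) x hx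
    obtain ⟨u, hu, rfl⟩ := Sym2.mem_map.1 hw
    obtain ⟨u', hu', e''⟩ := Sym2.mem_map.1 hw'
    exact ⟨u, hu, hf e'' ▸ hu', rfl⟩

/-- If all degrees were at least six, every end of an edge would lie on another edge, so `|E| <
3|V|`, against `2|E| ≥ 6|V|`. -/
theorem IsPlanar.exists_degree_le_five {V : Type*} [Fintype V] [Nonempty V]
    {G : SimpleGraph V} [DecidableRel G.Adj] (hG : G.IsPlanar) : ∃ v, G.degree v ≤ 5 := by
  classical
  by_contra! hdeg
  have h1 := hG.card_edgeSet_lt (by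
    rintro e v hv
    have hc : 1 < (G.incidenceFinset v).card := by
      rw [card_incidenceFinset_eq_degree]; exact (by norm_num : 1 < 6).trans_le (hdeg v)
    obtain ⟨f, hf, hfe⟩ := Finset.exists_mem_ne hc (e : Sym2 V)
    rw [mem_incidenceFinset] at hf
    exact ⟨⟨f, hf.1⟩, fun hc => hfe (congrArg Subtype.val hc), hf.2⟩)
  have h2 := G.sum_degrees_eq_twice_card_edges
  have h3 : ∑ _v : V, 6 ≤ ∑ v, G.degree v := Finset.sum_le_sum fun v _ => hdeg v
  rw [Finset.sum_const, Finset.card_univ, smul_eq_mul] at h3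
  rw [← edgeFinset_card] at h1
  lia

/-- A planar graph with an edge has a nonisolated vertex of degree at most five. -/
theorem IsPlanar.exists_adj_degree_le_five {V : Type*} [Fintype V] {G : SimpleGraph V}
    [DecidableRel G.Adj] (hG : G.IsPlanar) (hne : G ≠ ⊥) :
    ∃ v w, G.Adj v w ∧ G.degree v ≤ 5 := by
  classical
  obtain ⟨a, b, hab⟩ := ne_bot_iff_exists_adj.1 hne
  -- Passing to the support discards the isolated vertices and no neighbors.
  have : Nonempty G.support := ⟨a, b, hab⟩
  have hP : (G.induce G.support).IsPlanar :=
    hG.of_injective_hom (Embedding.induce G.support).toHom Subtype.val_injective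
  obtain ⟨⟨v, w, hvw⟩, hv⟩ := hP.exists_degree_le_five
  refine ⟨v, w, hvw, le_trans ?_ hv⟩
  rw [← card_neighborFinset_eq_degree, ← card_neighborFinset_eq_degree]
  refine Finset.card_le_card_of_surjOn (fun x => (x : V)) fun x hx => ?_
  have hx' : G.Adj v x := by simpa using hx
  exact ⟨⟨x, v, hx'.symm⟩, by simpa using hx', rfl⟩

end SimpleGraph

/-! ### Greedy extension of colorings -/

theorem Finset.exists_notMem_of_card_lt_fin {k : ℕ} (s : Finset (Fin k)) (hs : s.card < k) :
    ∃ x, x ∉ s := by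
  by_contra! h
  rw [Finset.eq_univ_of_forall h, Finset.card_univ, Fintype.card_fin] at hs
  exact hs.false

/-- A partial proper coloring with more than `Δ` colors extends greedily. -/
theorem SimpleGraph.exists_coloring_extension {V : Type*} [Fintype V] (G : SimpleGraph V)
    [DecidableRel G.Adj] {k : ℕ} (hk : ∀ v, G.degree v < k) (A : Finset V) (c₀ : V → Fin k)
    (hc₀ : ∀ u ∈ A, ∀ v ∈ A, G.Adj u v → c₀ u ≠ c₀ v) :
    ∃ c : G.Coloring (Fin k), ∀ v ∈ A, c v = c₀ v := by
  classical
  suffices h : ∀ B : Finset V, ∃ c : V → Fin k, (∀ v ∈ A, c v = c₀ v) ∧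
      ∀ u ∈ A ∪ B, ∀ v ∈ A ∪ B, G.Adj u v → c u ≠ c v by
    obtain ⟨c, hc, hp⟩ := h Finset.univ
    exact ⟨Coloring.mk c fun {u v} huv => hp u (by simp) v (by simp) huv, hc⟩
  intro B
  induction B using Finset.induction_on with
  | empty => exact ⟨c₀, fun _ _ => rfl, by simpa using hc₀⟩
  | insert w B _ ih =>
    obtain ⟨c, hc, hp⟩ := ih
    rw [Finset.union_insert]
    by_cases hw : w ∈ A ∪ B
    · rw [Finset.insert_eq_of_mem hw]
      exact ⟨c, hc, hp⟩
    obtain ⟨x, hx⟩ := Finset.exists_notMem_of_card_lt_fin ((G.neighborFinset w).image c)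
      (Finset.card_image_le.trans_lt (by simpa using hk w))
    have hx' : ∀ u, G.Adj w u → x ≠ c u := fun u hu e =>
      hx (Finset.mem_image.2 ⟨u, by simpa using hu, e.symm⟩)
    have hupd : ∀ u ∈ A ∪ B, Function.update c w x u = c u := fun u hu =>
      Function.update_of_ne (by rintro rfl; exact hw hu) _ _
    refine ⟨Function.update c w x, fun v hv => ?_, fun u hu v hv huv => ?_⟩
    · rw [hupd v (Finset.mem_union_left _ hv), hc v hv]
    · rcases Finset.mem_insert.1 hu with rfl | hu' <;>
        rcases Finset.mem_insert.1 hv with rfl | hv'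
      · exact absurd huv (G.loopless.irrefl _)
      · rw [hupd v hv', Function.update_self]
        exact hx' v huv
      · rw [hupd u hu', Function.update_self]
        exact (hx' u huv.symm).symm
      · rw [hupd u hu', hupd v hv']
        exact hp u hu' v hv' huv

/-- `c` properly colors the edges in `A`, none of which has the color of one of its ends. -/
structure IsEdgeColoringOn {V : Type*} {k : ℕ} (A : Finset (Sym2 V)) (vc : V → Fin k)
    (c : Sym2 V → Fin k) : Prop where
  ne_edge : ∀ e ∈ A, ∀ f ∈ A, e ≠ f → ∀ v ∈ e, v ∈ f → c e ≠ c f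
  ne_vert : ∀ e ∈ A, ∀ v ∈ e, c e ≠ vc v

/-- One more edge can be colored if it meets few colored edges. -/
theorem IsEdgeColoringOn.exists_update {V : Type*} [DecidableEq V] {k : ℕ} {A : Finset (Sym2 V)}
    {vc : V → Fin k} {c : Sym2 V → Fin k} {v w : V} (h : IsEdgeColoringOn (A.erase s(v, w)) vc c)
    (hk : ((A.erase s(v, w)).filter (v ∈ ·)).card +
      ((A.erase s(v, w)).filter (w ∈ ·)).card + 2 < k) :
    ∃ x, IsEdgeColoringOn A vc (Function.update c s(v, w) x) := by
  obtain ⟨x, hx⟩ := Finset.exists_notMem_of_card_lt_fin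
    ((((A.erase s(v, w)).filter (v ∈ ·)).image c ∪ ((A.erase s(v, w)).filter (w ∈ ·)).image c) ∪
      {vc v, vc w}) (by
    refine lt_of_le_of_lt ((Finset.card_union_le _ _).trans (add_le_add
      ((Finset.card_union_le _ _).trans (add_le_add Finset.card_image_le Finset.card_image_le))
      Finset.card_le_two)) hk)
  simp only [Finset.mem_union, Finset.mem_image, Finset.mem_filter, Finset.mem_insert,
    Finset.mem_singleton, not_or, not_exists, not_and] at hx
  obtain ⟨⟨hxv, hxw⟩, hxv', hxw'⟩ := hx
  have hnew : ∀ f ∈ A, f ≠ s(v, w) → ∀ u ∈ s(v, w), u ∈ f → c f ≠ x := by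
    intro f hf hne u hu huf
    rcases Sym2.mem_iff.1 hu with rfl | rfl
    · exact hxv f ⟨Finset.mem_erase.2 ⟨hne, hf⟩, huf⟩
    · exact hxw f ⟨Finset.mem_erase.2 ⟨hne, hf⟩, huf⟩
  refine ⟨x, fun e he f hf hef u hue huf => ?_, fun e he u hue => ?_⟩
  · by_cases h1 : e = s(v, w)
    · subst h1
      rw [Function.update_self, Function.update_of_ne hef.symm]
      exact (hnew f hf hef.symm u hue huf).symm
    by_cases h2 : f = s(v, w)
    · subst h2
      rw [Function.update_self, Function.update_of_ne hef]
      exact hnew e he hef u huf hue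
    · rw [Function.update_of_ne h1, Function.update_of_ne h2]
      exact h.ne_edge e (Finset.mem_erase.2 ⟨h1, he⟩) f (Finset.mem_erase.2 ⟨h2, hf⟩) hef u hue huf
  · by_cases h1 : e = s(v, w)
    · subst h1
      rw [Function.update_self]
      rcases Sym2.mem_iff.1 hue with rfl | rfl
      · exact hxv'
      · exact hxw'
    · rw [Function.update_of_ne h1]
      exact h.ne_vert e (Finset.mem_erase.2 ⟨h1, he⟩) u hue

/-- A partial edge coloring of a planar graph that avoids the colors of the ends extends to all
edges, if each vertex has at most `d` colored edges and there are `Δ + d + 6` colors. -/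
theorem SimpleGraph.IsPlanar.exists_edgeColoring_extension {V : Type*} [Fintype V] [DecidableEq V]
    {G : SimpleGraph V} [DecidableRel G.Adj] (hG : G.IsPlanar) {d Δ k : ℕ}
    (hΔ : ∀ v, G.degree v ≤ Δ) (hk : Δ + d + 6 ≤ k) (M : Finset (Sym2 V))
    (hM : ∀ v, (M.filter (v ∈ ·)).card ≤ d) (vc : V → Fin k) (c₀ : Sym2 V → Fin k)
    (hc₀ : IsEdgeColoringOn M vc c₀) (A : Finset (Sym2 V)) (hMA : M ⊆ A) (hA : A ⊆ G.edgeFinset) :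
    ∃ c, (∀ e ∈ M, c e = c₀ e) ∧ IsEdgeColoringOn A vc c := by
  induction A using Finset.strongInduction with
  | H A ih =>
  by_cases hAM : A = M
  · subst hAM
    exact ⟨c₀, fun _ _ => rfl, hc₀⟩
  -- Leaving out `M` lets the edges of `M` at `v` be bounded by `d`, and the others by the degree in
  -- `F`.
  let F : SimpleGraph V := SimpleGraph.fromEdgeSet (↑(A \ M) : Set (Sym2 V))
  have hFadj : ∀ u v, F.Adj u v ↔ s(u, v) ∈ A \ M := by
    intro u v
    rw [SimpleGraph.fromEdgeSet_adj, Finset.mem_coe, and_iff_left_iff_imp]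
    intro h
    have := hA (Finset.mem_sdiff.1 h).1
    rw [SimpleGraph.mem_edgeFinset, SimpleGraph.mem_edgeSet] at this
    exact this.ne
  have hFG : F ≤ G := by
    intro u v huv
    have := hA (Finset.mem_sdiff.1 ((hFadj u v).1 huv)).1
    rwa [SimpleGraph.mem_edgeFinset, SimpleGraph.mem_edgeSet] at this
  have hFne : F ≠ ⊥ := by
    obtain ⟨e, he, heM⟩ := Finset.exists_of_ssubset (hMA.ssubset_of_ne (Ne.symm hAM))
    rw [SimpleGraph.ne_bot_iff_exists_adj]
    induction e with
    | _ u v => exact ⟨u, v, (hFadj u v).2 (Finset.mem_sdiff.2 ⟨he, heM⟩)⟩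
  have : DecidableRel F.Adj := Classical.decRel _
  obtain ⟨v, w, hvw, hdeg⟩ := (hG.of_injective_hom (SimpleGraph.Hom.ofLE hFG)
    Function.injective_id).exists_adj_degree_le_five hFne
  obtain ⟨heA, heM⟩ := Finset.mem_sdiff.1 ((hFadj v w).1 hvw)
  obtain ⟨c, hcM, hc⟩ := ih (A.erase s(v, w)) (Finset.erase_ssubset heA)
    (Finset.subset_erase.2 ⟨hMA, heM⟩) ((Finset.erase_subset _ _).trans hA)
  -- At most `d` edges of `M`, and at most five edges of `F` less `vw` itself.
  have h1 : ((A.erase s(v, w)).filter (v ∈ ·)).card ≤ d + 4 := by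
    have hsub : (A.erase s(v, w)).filter (v ∈ ·) ⊆
        M.filter (v ∈ ·) ∪ (F.incidenceFinset v).erase s(v, w) := by
      intro f hf
      simp only [Finset.mem_filter, Finset.mem_erase, Finset.mem_union,
        SimpleGraph.mem_incidenceFinset] at hf ⊢
      by_cases hfM : f ∈ M
      · exact Or.inl ⟨hfM, hf.2⟩
      · refine Or.inr ⟨hf.1.1, ?_, hf.2⟩
        induction f with
        | _ a b =>
          rw [SimpleGraph.mem_edgeSet, hFadj]
          exact Finset.mem_sdiff.2 ⟨hf.1.2, hfM⟩
    have he : s(v, w) ∈ F.incidenceFinset v := by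
      rw [SimpleGraph.mem_incidenceFinset]; exact ⟨hvw, Sym2.mem_mk_left _ _⟩
    have h2 := (Finset.card_le_card hsub).trans (Finset.card_union_le _ _)
    rw [Finset.card_erase_of_mem he, SimpleGraph.card_incidenceFinset_eq_degree] at h2
    have := hM v
    lia
  have h2 : ((A.erase s(v, w)).filter (w ∈ ·)).card + 1 ≤ Δ := by
    have hsub : (A.erase s(v, w)).filter (w ∈ ·) ⊆ (G.incidenceFinset w).erase s(v, w) := by
      intro f hf
      simp only [Finset.mem_filter, Finset.mem_erase, SimpleGraph.mem_incidenceFinset] at hf ⊢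
      exact ⟨hf.1.1, SimpleGraph.mem_edgeFinset.1 (hA hf.1.2), hf.2⟩
    have he : s(v, w) ∈ G.incidenceFinset w := by
      rw [SimpleGraph.mem_incidenceFinset]; exact ⟨hFG hvw, Sym2.mem_mk_right _ _⟩
    have h3 := Finset.card_le_card hsub
    have h4 : 0 < (G.incidenceFinset w).card := Finset.card_pos.2 ⟨_, he⟩
    rw [Finset.card_erase_of_mem he] at h3
    rw [SimpleGraph.card_incidenceFinset_eq_degree] at h3 h4
    have := hΔ w
    lia
  -- The count is `(d + 4) + (Δ - 1) + 2 = Δ + d + 5 < k`.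
  obtain ⟨x, hx⟩ := hc.exists_update (by lia)
  refine ⟨_, fun e he => ?_, hx⟩
  rw [Function.update_of_ne (by rintro rfl; exact heM he), hcM e he]

/-- The vertices can be colored first without regard to the edges: both ends of an edge of `H` lie
in `H`, so new vertex colors cannot clash with `φ.edge`. The hypothesis `hφ` is what makes the given
vertex colors proper in `G`. -/
theorem mainTheorem3 {V : Type*} [Fintype V] (G : SimpleGraph V) [DecidableRel G.Adj]
    (hG : G.IsPlanar) (H : G.Subgraph) [Fintype H.verts] [DecidableRel H.coe.Adj]
    (Δ d : ℕ) (hΔ : G.maxDegree = Δ) (hd : H.coe.maxDegree = d)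
    (φ : TotalColoring H.coe (Δ + d + 6)) (hφ : φ.IsColoringIn) :
    ∃ ψ : TotalColoring G (Δ + d + 6), ψ.Extends φ := by
  classical
  have hΔ' : ∀ v, G.degree v ≤ Δ := fun v => hΔ ▸ G.degree_le_maxDegree v
  -- An arbitrary color off `H`; the extension lemmas use the initial colors only on `H`.
  let col : Fin (Δ + d + 6) := ⟨0, by lia⟩
  let v₀ : V → Fin (Δ + d + 6) := Function.extend (Subtype.val : H.verts → V) φ.vert fun _ => col
  have hv₀ : ∀ v : H.verts, v₀ v = φ.vert v := fun v => Subtype.val_injective.extend_apply _ _ v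
  obtain ⟨vc, hvc⟩ := G.exists_coloring_extension (fun v => (hΔ' v).trans_lt (by lia))
    H.verts.toFinset v₀ (by
      intro u hu v hv huv
      rw [Set.mem_toFinset] at hu hv
      rw [hv₀ ⟨u, hu⟩, hv₀ ⟨v, hv⟩]
      exact hφ ⟨u, hu⟩ ⟨v, hv⟩ huv)
  have hvc' : ∀ v : H.verts, vc v = φ.vert v := fun v => by
    rw [hvc v (Set.mem_toFinset.2 v.2), hv₀]
  let g : H.coe.edgeSet → Sym2 V := fun e => (e : Sym2 H.verts).map Subtype.val
  have hg : Function.Injective g :=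
    (Sym2.map.injective Subtype.val_injective).comp Subtype.val_injective
  let c₀ : Sym2 V → Fin (Δ + d + 6) := Function.extend g φ.edge fun _ => col
  have hc₀ : ∀ e, c₀ (g e) = φ.edge e := fun e => hg.extend_apply _ _ e
  have hM : ∀ v, ((Finset.univ.image g).filter (v ∈ ·)).card ≤ d := by
    intro v
    by_cases hv : v ∈ H.verts
    · refine le_trans (Finset.card_le_card (t := (H.coe.incidenceFinset ⟨v, hv⟩).image
        (Sym2.map Subtype.val)) fun f hf => ?_) (Finset.card_image_le.trans ?_)
      · obtain ⟨hf, hvf⟩ := Finset.mem_filter.1 hf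
        obtain ⟨e, -, rfl⟩ := Finset.mem_image.1 hf
        refine Finset.mem_image.2 ⟨e, ?_, rfl⟩
        obtain ⟨u, hu, rfl⟩ := Sym2.mem_map.1 hvf
        rw [SimpleGraph.mem_incidenceFinset]
        exact ⟨e.2, hu⟩
      · rw [SimpleGraph.card_incidenceFinset_eq_degree, ← hd]
        refine le_of_eq_of_le ?_ (H.coe.degree_le_maxDegree ⟨v, hv⟩)
        congr!
    · rw [Finset.filter_false_of_mem, Finset.card_empty]
      · exact Nat.zero_le d
      · intro f hf hvf
        obtain ⟨e, -, rfl⟩ := Finset.mem_image.1 hf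
        obtain ⟨u, -, rfl⟩ := Sym2.mem_map.1 hvf
        exact hv u.2
  have hcol : IsEdgeColoringOn (Finset.univ.image g) vc c₀ := by
    refine ⟨?_, ?_⟩
    · intro e he f hf hef v hve hvf
      obtain ⟨e, -, rfl⟩ := Finset.mem_image.1 he
      obtain ⟨f, -, rfl⟩ := Finset.mem_image.1 hf
      obtain ⟨u, hu, rfl⟩ := Sym2.mem_map.1 hve
      obtain ⟨u', hu', hu''⟩ := Sym2.mem_map.1 hvf
      rw [hc₀, hc₀]
      exact φ.edge.valid ⟨fun h => hef (h ▸ rfl), u, hu, Subtype.ext hu'' ▸ hu'⟩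
    · intro e he v hv
      obtain ⟨e, -, rfl⟩ := Finset.mem_image.1 he
      obtain ⟨u, hu, rfl⟩ := Sym2.mem_map.1 hv
      rw [hc₀, hvc']
      exact φ.edge_ne_vert e u hu
  have hsub : Finset.univ.image g ⊆ G.edgeFinset := by
    intro f hf
    obtain ⟨e, -, rfl⟩ := Finset.mem_image.1 hf
    exact SimpleGraph.mem_edgeFinset.2 (H.hom.mapEdgeSet e).2
  obtain ⟨c, hcM, hc⟩ := hG.exists_edgeColoring_extension hΔ' le_rfl _ hM vc c₀ hcol
    G.edgeFinset hsub subset_rfl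
  refine ⟨⟨vc, SimpleGraph.Coloring.mk (fun e => c e) ?_, ?_⟩, hvc', fun e => ?_⟩
  · rintro e f ⟨hne, v, hve, hvf⟩
    exact hc.ne_edge e (SimpleGraph.mem_edgeFinset.2 e.2) f (SimpleGraph.mem_edgeFinset.2 f.2)
      (fun h => hne (Subtype.ext h)) v hve hvf
  · exact fun e v hv => hc.ne_vert e (SimpleGraph.mem_edgeFinset.2 e.2) v hv
  · exact (hcM (g e) (Finset.mem_image_of_mem g (Finset.mem_univ e))).trans (hc₀ e)
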